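/- For $c\in\mathbb R$ let $\mathbb H_c=\{z\in\mathbb C:\operatorname{Re} z>c\}$. For $\alpha>0$, $\beta\in\mathbb R$ let $T_{\alpha,\beta}:\mathbb R\to\mathbb R$ be given by $T_{\alpha,\beta}(x)=\frac{\alpha}{2}\left(\frac{x+\beta}{\alpha}-\frac{\alpha}{x-\beta}\right)$ for $x\neq\beta$ and $T_{\alpha,\beta}(\beta)=\beta$, and let $\mu_{\alpha,\beta}$ be the Cauchy probability measure $\mu_{\alpha,\beta}(A)=\frac{\alpha}{\pi}\int_A\frac{dt}{\alpha^2+(t-\beta)^2}$. A sequence $(k_n)_{n\ge 0}$ of natural numbers is $L^p$-good universal ($1\le p\le\infty$) if for every probability space $(X,\mathcal A,\mu)$, every measurable $\mu$-preserving $T:X\to X$ and every $g\in L^p(\mu)$ the limit $\lim_{N\to\infty}\frac1N\sum_{n=0}^{N-1}g(T^{k_n}x)$ exists for $\mu$-almost every $x$. It is Hartman uniformly distributed if it is uniformly distributed among the residue classes modulo $m$ for every integer $m>1$, and $(k_n\theta)_n$ is uniformly distributed modulo one for every irrational $\theta$. Theorem. Let $f$ be a meromorphic function on $\mathbb H_c$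 such that (1) there are $K>0$ and $c'>c$ with $|f(\sigma+it)|\le K$ for all $\sigma>c'$ and $t\in\mathbb R$; (2) there is a non-increasing $\nu:(c,\infty)\to\mathbb R$ with $\nu(\sigma)\le 1+c-\sigma$ for all $\sigma>c$ sufficiently near $c$, and such that for every $\sigma>c$ and every $\epsilon>0$, $f(\sigma+it)=O(|t|^{\nu(\sigma)+\epsilon})$ as $|t|\to\infty$ (the implied constant may depend on $f,\sigma,\epsilon$); (3) $f$ has at most one pole in $\mathbb H_c$ (of any finite order $m$); if there is one, call it $s_0$. Let $\alpha>0$, $\beta\in\mathbb R$, $1\le p\le\infty$, let $(k_n)$ be $L^p$-good universal and Hartman uniformly distributed, and let $s\in\mathbb H_c$, with $\operatorname{Re}s\ne\operatorname{Re}s_0$ if $f$ has a pole. Then: (a) $\tau\mapsto f(s+i\tau)$ belongs to $L^q(\mu_{\alpha,\beta})$ for every real $q\ge1$ with $q\,\nu(\operatorname{Re}s)<1$ (which always includes $q=1$), and the integral $\int_{\mathbb R}\frac{f(s+i\tau)}{\alpha^2+(\tau-\beta)^2}\,d\tau$ converges absolutely; (b) if $\tau\mapsto f(s+i\tau)$ belongs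 to $L^p(\mu_{\alpha,\beta})$ (as is automatic for $p=1$), or if the $k_n$ are pairwise distinct, then for Lebesgue-almost every $x\in\mathbb R$ $$\lim_{N\to\infty}\frac1N\sum_{n=0}^{N-1}f\bigl(s+iT_{\alpha,\beta}^{k_n}(x)\bigr)=\frac{\alpha}{\pi}\int_{\mathbb R}\frac{f(s+i\tau)}{\alpha^2+(\tau-\beta)^2}\,d\tau .$$ -/

import Mathlib

open MeasureTheory Filter Topology

/-- The generalised Boole map `T_{α,β}` of the real line. -/
noncomputable def booleMap (α β x : ℝ) : ℝ :=
  open Classical in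
  if x = β then β else α / 2 * ((x + β) / α - α / (x - β))

/-- `k` is `L^p`-good universal: for every measure preserving system on a probability space
and every `g ∈ L^p`, the averages of `g` along the times `k n` converge almost everywhere. -/
def IsGoodUniversal (p : ENNReal) (k : ℕ → ℕ) : Prop :=
  ∀ (X : Type) (_ : MeasurableSpace X) (μ : Measure X), IsProbabilityMeasure μ →
    ∀ T : X → X, MeasurePreserving T μ μ →
      ∀ g : X → ℂ, MemLp g p μ →
        ∀ᵐ x ∂μ, ∃ l : ℂ,
          Tendsto (fun N : ℕ => (1 / (N : ℂ)) * ∑ n ∈ Finset.range N, g (T^[k n] x))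
            atTop (𝓝 l)

/-- The proportion of indices `n < N` with `P n` tends to `d` as `N → ∞`. -/
def HasFrequency (P : ℕ → Prop) (d : ℝ) : Prop :=
  open Classical in
  Tendsto (fun N : ℕ => (((Finset.range N).filter P).card : ℝ) / (N : ℝ)) atTop (𝓝 d)

/-- Uniform distribution modulo one of a real sequence. -/
def UniformlyDistributedModOne (x : ℕ → ℝ) : Prop :=
  ∀ a b : ℝ, 0 ≤ a → a ≤ b → b ≤ 1 →
    HasFrequency (fun n => Int.fract (x n) ∈ Set.Ico a b) (b - a)

/-- Uniform distribution of a sequence of natural numbers among the residue classes of every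
modulus. -/
def UniformlyDistributedInt (k : ℕ → ℕ) : Prop :=
  ∀ m : ℕ, 1 < m → ∀ j : ℕ, j < m → HasFrequency (fun n => k n % m = j) (1 / (m : ℝ))

/-- Hartman uniform distribution of a sequence of natural numbers. -/
def HartmanUniformlyDistributed (k : ℕ → ℕ) : Prop :=
  UniformlyDistributedInt k ∧
    ∀ θ : ℝ, Irrational θ → UniformlyDistributedModOne (fun n => (k n : ℝ) * θ)

/-- `z` is a pole of `f`. -/
def IsPoleOf (f : ℂ → ℂ) (z : ℂ) : Prop :=
  MeromorphicAt f z ∧ meromorphicOrderAt f z < 0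

/-- `f` is a meromorphic function on `U`: it is meromorphic in the sense of having Laurent
expansions with finite principal part, and it has no removable singularities, i.e. it is
analytic at each point of `U` that is not a pole. Its values at poles are irrelevant. -/
def IsMeromorphicFunctionOn (f : ℂ → ℂ) (U : Set ℂ) : Prop :=
  MeromorphicOn f U ∧ ∀ z ∈ U, ¬ IsPoleOf f z → AnalyticAt ℂ f z

/-! The substitution `x = β + α cot(π u)` carries the Cauchy measure to Lebesgue measure on the
circle and, by the double angle formula for the cotangent, carries `T_{α,β}` to `u ↦ 2u`
(`measurePreserving_lineToCircle`, `lineToCircle_booleMap`). It therefore suffices to study averages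
along `k n` for the doubling map.

For observables in `L^p`, good universality supplies a pointwise limit, and only its value has to be
found. Convergence to the space average in `L¹` is enough for this, and by density it need only be
checked on characters. For `j ≠ 0`, the character of frequency `j` at time `k n` becomes the one of
frequency `2 ^ k n * j`, so by orthogonality the squared `L²` norm of the average is the proportion
of pairs with `k n = k m`. Equidistribution modulo every `M` forces this to vanish
(`tendsto_coincidence_frequency`).

On the vertical line through `s` there is no pole, and the growth exponent `ν` is below one by
monotonicity and its bound near `c`. So `f` grows like `|t|^κ` with `κ < 1`, which gives
integrability; on the circle it becomes a singularity of order `|u|^(-κ)` at the origin. If `f` is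
not in `L^p` but the times are distinct, the singularity is cut off. The truncated function is
bounded, hence in `L^p`. The remainder is dominated by a step function on dyadic arcs whose values
at times at least `J` apart are exactly uncorrelated. A variance bound (`integral_sq_sum_sub_le`),
Chebyshev and Borel–Cantelli along geometrically growing `N` make its averages uniformly small
(`ae_eventually_average_indicator_le`). -/

/-! ### Averages along a sequence of times -/

/-- The average of `G` along the times `k 0, …, k (N - 1)` of the orbit of `x` under `T`. -/
noncomputable def timeAverage {X : Type*} (T : X → X) (k : ℕ → ℕ) (G : X → ℂ) (N : ℕ) (x : X) : ℂ :=
  (1 / (N : ℂ)) * ∑ n ∈ Finset.range N, G (T^[k n] x)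

section Averages

variable {X : Type*} {T : X → X} {k : ℕ → ℕ}

lemma timeAverage_add (F G : X → ℂ) (N : ℕ) (x : X) :
    timeAverage T k (F + G) N x = timeAverage T k F N x + timeAverage T k G N x := by
  simp [timeAverage, Finset.sum_add_distrib, mul_add]

lemma timeAverage_smul (c : ℂ) (G : X → ℂ) (N : ℕ) (x : X) :
    timeAverage T k (c • G) N x = c * timeAverage T k G N x := by
  simp only [timeAverage, Pi.smul_apply, smul_eq_mul, ← Finset.mul_sum]
  ring

lemma norm_timeAverage_le (G : X → ℂ) (N : ℕ) (x : X) :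
    ‖timeAverage T k G N x‖ ≤ (1 / (N : ℝ)) * ∑ n ∈ Finset.range N, ‖G (T^[k n] x)‖ := by
  rw [timeAverage, norm_mul]
  have : ‖(1 / (N : ℂ))‖ = 1 / (N : ℝ) := by simp
  rw [this]
  exact mul_le_mul_of_nonneg_left (norm_sum_le _ _) (by positivity)

variable [MeasurableSpace X] {μ : Measure X}

lemma aestronglyMeasurable_timeAverage (hT : MeasurePreserving T μ μ) {G : X → ℂ}
    (hG : AEStronglyMeasurable G μ) (N : ℕ) : AEStronglyMeasurable (timeAverage T k G N) μ := by
  refine AEStronglyMeasurable.const_mul ?_ _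
  exact Finset.aestronglyMeasurable_fun_sum _ fun n _ =>
    hG.comp_measurePreserving (hT.iterate (k n))

lemma eLpNorm_timeAverage_le (hT : MeasurePreserving T μ μ) {G : X → ℂ}
    (hG : AEStronglyMeasurable G μ) (N : ℕ) :
    eLpNorm (timeAverage T k G N) 1 μ ≤ eLpNorm G 1 μ := by
  have h1 : timeAverage T k G N = (1 / (N : ℂ)) • ∑ n ∈ Finset.range N, G ∘ T^[k n] := by
    ext x; simp [timeAverage]
  have h2 : eLpNorm (∑ n ∈ Finset.range N, G ∘ T^[k n]) 1 μ ≤ N * eLpNorm G 1 μ := by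
    refine (eLpNorm_sum_le (fun n _ => hG.comp_measurePreserving (hT.iterate (k n))) le_rfl).trans ?_
    rw [Finset.sum_congr rfl fun n _ => eLpNorm_comp_measurePreserving hG (hT.iterate (k n))]
    simp
  rw [h1, eLpNorm_const_smul]
  rcases Nat.eq_zero_or_pos N with rfl | hN
  · simp
  calc _ ≤ ‖(1 / (N : ℂ))‖ₑ * (N * eLpNorm G 1 μ) := by gcongr
    _ = eLpNorm G 1 μ := by
      rw [← mul_assoc]
      have : ‖(1 / (N : ℂ))‖ₑ * (N : ENNReal) = 1 := by
        have h3 : ‖(1 / (N : ℂ))‖ₑ * ‖(N : ℂ)‖ₑ = 1 := by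
          rw [← enorm_mul, one_div, inv_mul_cancel₀ (by exact_mod_cast hN.ne')]; simp
        rwa [show ‖(N : ℂ)‖ₑ = (N : ENNReal) by
          rw [← ofReal_norm]; simp] at h3
      rw [this, one_mul]

/-- Distance in `L¹` from the time average to the space average. -/
noncomputable def averageDeviation (T : X → X) (k : ℕ → ℕ) (μ : Measure X) (G : X → ℂ) (N : ℕ) :
    ENNReal :=
  eLpNorm (fun x => timeAverage T k G N x - ∫ y, G y ∂μ) 1 μ

lemma averageDeviation_add_le [IsProbabilityMeasure μ] (hT : MeasurePreserving T μ μ) {F G : X → ℂ}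
    (hF : Integrable F μ) (hG : Integrable G μ) (N : ℕ) :
    averageDeviation T k μ (F + G) N ≤ averageDeviation T k μ F N + averageDeviation T k μ G N := by
  unfold averageDeviation
  have : (fun x => timeAverage T k (F + G) N x - ∫ y, (F + G) y ∂μ) =
      (fun x => timeAverage T k F N x - ∫ y, F y ∂μ) +
        fun x => timeAverage T k G N x - ∫ y, G y ∂μ := by
    ext x
    simp only [timeAverage_add, Pi.add_apply]
    rw [integral_add hF hG]; ring
  rw [this]
  exact eLpNorm_add_le
    ((aestronglyMeasurable_timeAverage hT hF.1 N).sub aestronglyMeasurable_const)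
    ((aestronglyMeasurable_timeAverage hT hG.1 N).sub aestronglyMeasurable_const) le_rfl

lemma averageDeviation_smul (c : ℂ) (G : X → ℂ) (N : ℕ) :
    averageDeviation T k μ (c • G) N = ‖c‖ₑ * averageDeviation T k μ G N := by
  unfold averageDeviation
  rw [← eLpNorm_const_smul]
  congr 1
  ext x
  simp only [timeAverage_smul, Pi.smul_apply, smul_eq_mul]
  rw [integral_const_mul]; ring

lemma averageDeviation_le [IsProbabilityMeasure μ] (hT : MeasurePreserving T μ μ) {G : X → ℂ} (hG : Integrable G μ) (N : ℕ) :
    averageDeviation T k μ G N ≤ 2 * eLpNorm G 1 μ := by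
  unfold averageDeviation
  refine (eLpNorm_sub_le (aestronglyMeasurable_timeAverage hT hG.1 N) aestronglyMeasurable_const
    le_rfl).trans ?_
  rw [two_mul]
  gcongr
  · exact eLpNorm_timeAverage_le hT hG.1 N
  · rw [eLpNorm_const' _ one_ne_zero ENNReal.one_ne_top, eLpNorm_one_eq_lintegral_enorm]
    simpa using enorm_integral_le_lintegral_enorm G

lemma averageDeviation_congr_ae (hT : MeasurePreserving T μ μ) {F G : X → ℂ} (h : F =ᵐ[μ] G)
    (N : ℕ) : averageDeviation T k μ F N = averageDeviation T k μ G N := by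
  unfold averageDeviation
  rw [integral_congr_ae h]
  refine eLpNorm_congr_ae ?_
  have : ∀ n, ∀ᵐ x ∂μ, F (T^[k n] x) = G (T^[k n] x) := fun n =>
    (hT.iterate (k n)).quasiMeasurePreserving.ae_eq_comp h
  filter_upwards [ae_all_iff.2 this] with x hx
  simp [timeAverage, hx]

/-- The deviation is a seminorm in the observable, bounded by twice the `L¹` norm uniformly in `N`.
Hence the observables for which it tends to zero form a closed subspace of `L¹`. -/
lemma tendsto_averageDeviation_of_dense [IsProbabilityMeasure μ] (hT : MeasurePreserving T μ μ) (s : Set (Lp ℂ 1 μ))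
    (hs : (Submodule.span ℂ s).topologicalClosure = ⊤)
    (h : ∀ F ∈ s, Tendsto (averageDeviation T k μ F) atTop (𝓝 0)) {G : X → ℂ}
    (hG : Integrable G μ) : Tendsto (averageDeviation T k μ G) atTop (𝓝 0) := by
  have hspan : ∀ F ∈ Submodule.span ℂ s, Tendsto (averageDeviation T k μ F) atTop (𝓝 0) := by
    intro F hF
    induction hF using Submodule.span_induction with
    | mem F hF => exact h F hF
    | zero =>
      refine tendsto_const_nhds.congr fun N => ?_
      rw [averageDeviation_congr_ae hT (Lp.coeFn_zero ℂ 1 μ)]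
      simp [averageDeviation, timeAverage]
    | add F G _ _ hF hG =>
      refine tendsto_of_tendsto_of_tendsto_of_le_of_le tendsto_const_nhds
        (by simpa using hF.add hG) (fun _ => bot_le) fun N => ?_
      rw [averageDeviation_congr_ae hT (Lp.coeFn_add F G)]
      exact averageDeviation_add_le hT (L1.integrable_coeFn F) (L1.integrable_coeFn G) N
    | smul c F _ hF =>
      have := ENNReal.Tendsto.const_mul hF (Or.inr (enorm_ne_top (x := c)))
      rw [mul_zero] at this
      refine this.congr fun N => ?_
      rw [averageDeviation_congr_ae hT (Lp.coeFn_smul c F), averageDeviation_smul]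
  rw [ENNReal.tendsto_nhds_zero]
  intro ε hε
  obtain ⟨δ, hδ, hδε⟩ : ∃ δ : ENNReal, 0 < δ ∧ δ + 2 * δ ≤ ε := by
    refine ⟨ε / 3, ENNReal.div_pos hε.ne' (by simp), le_of_eq ?_⟩
    rw [← one_add_mul, show (1 + 2 : ENNReal) = 3 by norm_num]
    exact ENNReal.mul_div_cancel (by norm_num) (by norm_num)
  obtain ⟨F, hFs, hF⟩ : ∃ F ∈ Submodule.span ℂ s, eLpNorm (G - (F : X → ℂ)) 1 μ < δ := by
    have hmem : hG.toL1 G ∈ closure (Submodule.span ℂ s : Set (Lp ℂ 1 μ)) := by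
      rw [← Submodule.topologicalClosure_coe, hs]; trivial
    obtain ⟨F, hFs, hF⟩ := EMetric.mem_closure_iff.1 hmem δ hδ
    refine ⟨F, hFs, ?_⟩
    rw [Lp.edist_def] at hF
    refine lt_of_eq_of_lt (eLpNorm_congr_ae ?_) hF
    filter_upwards [hG.coeFn_toL1] with x hx
    simp only [Pi.sub_apply, hx]
  filter_upwards [(ENNReal.tendsto_nhds_zero.1 (hspan F hFs)) δ hδ] with N hN
  have hFi := L1.integrable_coeFn F
  calc averageDeviation T k μ G N = averageDeviation T k μ ((F : X → ℂ) + (G - (F : X → ℂ))) N := by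
        rw [add_sub_cancel]
    _ ≤ _ := averageDeviation_add_le hT hFi (hG.sub hFi) N
    _ ≤ δ + 2 * δ := by
      gcongr
      exact (averageDeviation_le hT (hG.sub hFi) N).trans (by gcongr)
    _ ≤ ε := hδε

/-- Convergence in `L¹` gives almost everywhere convergence along a subsequence, and that identifies
a pointwise limit already known to exist. -/
lemma ae_tendsto_timeAverage_of_exists_limit [IsProbabilityMeasure μ] (hT : MeasurePreserving T μ μ) {G : X → ℂ}
    (hG : Integrable G μ) (hdev : Tendsto (averageDeviation T k μ G) atTop (𝓝 0))
    (hlim : ∀ᵐ x ∂μ, ∃ l : ℂ, Tendsto (fun N => timeAverage T k G N x) atTop (𝓝 l)) :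
    ∀ᵐ x ∂μ, Tendsto (fun N => timeAverage T k G N x) atTop (𝓝 (∫ y, G y ∂μ)) := by
  have hmeas : TendstoInMeasure μ (fun N => timeAverage T k G N) atTop (fun _ => ∫ y, G y ∂μ) :=
    tendstoInMeasure_of_tendsto_eLpNorm (p := 1) one_ne_zero
      (fun N => aestronglyMeasurable_timeAverage hT hG.1 N) aestronglyMeasurable_const hdev
  obtain ⟨ns, hns, hae⟩ := hmeas.exists_seq_tendsto_ae
  filter_upwards [hlim, hae] with x ⟨l, hl⟩ hx
  rwa [tendsto_nhds_unique (hl.comp hns.tendsto_atTop) hx] at hl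

end Averages

/-! ### Counting coincidences -/

open Classical in
lemma card_coincidences_le (k : ℕ → ℕ) (M N : ℕ) (hM : 0 < M) :
    ((((Finset.range N ×ˢ Finset.range N).filter fun q => k q.1 = k q.2).card : ℕ) : ℝ) ≤
      ∑ j ∈ Finset.range M, (((Finset.range N).filter fun n => k n % M = j).card : ℝ) ^ 2 := by
  have hsub : ((Finset.range N ×ˢ Finset.range N).filter fun q => k q.1 = k q.2) ⊆
      (Finset.range M).biUnion fun j => ((Finset.range N).filter fun n => k n % M = j) ×ˢ
        ((Finset.range N).filter fun n => k n % M = j) := by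
    intro q hq
    simp only [Finset.mem_filter, Finset.mem_product, Finset.mem_biUnion] at hq ⊢
    exact ⟨k q.1 % M, Finset.mem_range.2 (Nat.mod_lt _ hM), ⟨hq.1.1, rfl⟩, hq.1.2, by rw [hq.2]⟩
  have := (Finset.card_le_card hsub).trans Finset.card_biUnion_le
  simp only [Finset.card_product, ← sq] at this
  exact_mod_cast this

open Classical in
-- Equal times share a residue modulo `M`. The proportion of pairs with a common residue tends to `M
-- · (1/M)² = 1/M`, and `M` is arbitrary.
lemma tendsto_coincidence_frequency {k : ℕ → ℕ} (hk : UniformlyDistributedInt k) :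
    Tendsto (fun N : ℕ => (((Finset.range N ×ˢ Finset.range N).filter
      fun q => k q.1 = k q.2).card : ℝ) / (N : ℝ) ^ 2) atTop (𝓝 0) := by
  have hlim : ∀ M : ℕ, 1 < M → Tendsto (fun N : ℕ => ∑ j ∈ Finset.range M,
      ((((Finset.range N).filter fun n => k n % M = j).card : ℝ) / (N : ℝ)) ^ 2) atTop
        (𝓝 (1 / (M : ℝ))) := by
    intro M hM
    have : (1 / (M : ℝ)) = ∑ j ∈ Finset.range M, (1 / (M : ℝ)) ^ 2 := by
      have : (M : ℝ) ≠ 0 := by positivity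
      simp; field_simp
    rw [this]
    refine tendsto_finsetSum _ fun j hj => ?_
    convert (hk M hM j (Finset.mem_range.1 hj)).pow 2
  refine Metric.tendsto_atTop.2 fun ε hε => ?_
  obtain ⟨M, hM⟩ := exists_nat_gt (max (1 / ε) 1)
  have hM1 : 1 < M := by exact_mod_cast (le_max_right _ _).trans_lt hM
  have hMε : 1 / (M : ℝ) < ε := by
    rw [one_div_lt (by positivity) hε]; exact (le_max_left _ _).trans_lt hM
  obtain ⟨N₀, hN₀⟩ := eventually_atTop.1 ((hlim M hM1).eventually_lt_const hMε)
  refine ⟨N₀, fun N hN => ?_⟩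
  rw [Real.dist_eq, sub_zero, abs_of_nonneg (by positivity)]
  refine lt_of_le_of_lt ?_ (hN₀ N hN)
  simp only [div_pow, ← Finset.sum_div]
  gcongr
  exact card_coincidences_le k M N (by omega)

/-! ### The doubling map on the circle -/

instance isProbabilityMeasure_volume_unitAddCircle :
    IsProbabilityMeasure (volume : Measure UnitAddCircle) := ⟨UnitAddCircle.measure_univ⟩

/-- The doubling map of the circle. -/
def doubling (u : UnitAddCircle) : UnitAddCircle := 2 • u

lemma measurePreserving_doubling : MeasurePreserving doubling volume volume :=
  (AddCircle.ergodic_nsmul (T := 1) one_lt_two).toMeasurePreserving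

lemma doubling_iterate (n : ℕ) (u : UnitAddCircle) : doubling^[n] u = 2 ^ n • u :=
  smul_iterate_apply 2 n u

lemma haarAddCircle_one_eq_volume :
    (AddCircle.haarAddCircle : Measure UnitAddCircle) = volume := by
  rw [AddCircle.volume_eq_smul_haarAddCircle]; simp

lemma integral_fourier (n : ℤ) :
    ∫ u : UnitAddCircle, (fourier n u : ℂ) = if n = 0 then 1 else 0 := by
  have h := congrFun (fourierCoeff_fourier (T := 1) n) 0
  simp only [fourierCoeff, neg_zero, fourier_zero, one_smul, haarAddCircle_one_eq_volume] at h
  rw [h]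
  simp [Pi.single_apply, eq_comm]

lemma fourier_nsmul (j : ℤ) (m : ℕ) (u : UnitAddCircle) :
    (fourier j (m • u) : ℂ) = fourier (m * j) u := by
  simp only [fourier_apply, ← natCast_zsmul, smul_smul, mul_comm j]

open Classical in
lemma integral_norm_sq_sum_fourier (a : ℕ → ℤ) (N : ℕ) :
    ∫ u : UnitAddCircle, ‖∑ n ∈ Finset.range N, (fourier (a n) u : ℂ)‖ ^ 2 =
      (((Finset.range N ×ˢ Finset.range N).filter fun q => a q.1 = a q.2).card : ℝ) := by
  have hint : ∀ n : ℤ, Integrable (fun u : UnitAddCircle => (fourier n u : ℂ)) := fun n =>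
    (fourier n).continuous.integrable_of_hasCompactSupport (HasCompactSupport.of_compactSpace _)
  have key : ∀ u : UnitAddCircle, ((‖∑ n ∈ Finset.range N, (fourier (a n) u : ℂ)‖ ^ 2 : ℝ) : ℂ) =
      ∑ q ∈ Finset.range N ×ˢ Finset.range N, (fourier (a q.1 - a q.2) u : ℂ) := by
    intro u
    rw [Complex.ofReal_pow, ← Complex.mul_conj', map_sum, Finset.sum_mul_sum, Finset.sum_product]
    refine Finset.sum_congr rfl fun n _ => Finset.sum_congr rfl fun m _ => ?_
    rw [sub_eq_add_neg, fourier_add, fourier_neg]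
  apply Complex.ofReal_injective
  rw [← integral_complex_ofReal]
  simp only [key]
  rw [integral_finsetSum _ fun q _ => hint _]
  simp only [integral_fourier, sub_eq_zero]
  simp

/-- The `L¹` norm is bounded by the `L²` norm, which orthogonality evaluates exactly. For `j ≠ 0`
the frequencies `2 ^ k n * j` coincide only when the times do. -/
lemma tendsto_averageDeviation_fourier {k : ℕ → ℕ} (hk : UniformlyDistributedInt k) (j : ℤ) :
    Tendsto (averageDeviation doubling k volume (fourier j : UnitAddCircle → ℂ)) atTop (𝓝 0) := by
  classical
  by_cases hj : j = 0
  · subst hj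
    refine tendsto_const_nhds.congr' ?_
    filter_upwards [eventually_gt_atTop 0] with N hN
    have : (N : ℂ) ≠ 0 := by exact_mod_cast hN.ne'
    simp [averageDeviation, timeAverage, this]
  have hcont : ∀ N, Continuous fun u : UnitAddCircle =>
      ∑ n ∈ Finset.range N, (fourier (((2 ^ k n : ℕ) : ℤ) * j) u : ℂ) := fun N => by fun_prop
  have hbound : ∀ N : ℕ, averageDeviation doubling k volume (fourier j : UnitAddCircle → ℂ) N ≤
      ENNReal.ofReal (Real.sqrt ((((Finset.range N ×ˢ Finset.range N).filter
        fun q => k q.1 = k q.2).card : ℝ) / (N : ℝ) ^ 2)) := by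
    intro N
    have hcard : ((Finset.range N ×ˢ Finset.range N).filter fun q => k q.1 = k q.2) =
        ((Finset.range N ×ˢ Finset.range N).filter
          fun q => (((2 ^ k q.1 : ℕ) : ℤ) * j) = (((2 ^ k q.2 : ℕ) : ℤ) * j)) := by
      refine Finset.filter_congr fun q _ => ?_
      rw [mul_left_inj' hj, Nat.cast_inj, Nat.pow_right_inj one_lt_two]
    rw [hcard, ← integral_norm_sq_sum_fourier (fun n => ((2 ^ k n : ℕ) : ℤ) * j), averageDeviation]
    refine (eLpNorm_le_eLpNorm_of_exponent_le (q := 2) one_le_two ?_).trans (le_of_eq ?_)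
    · exact (aestronglyMeasurable_timeAverage measurePreserving_doubling
        (fourier j).continuous.aestronglyMeasurable N).sub aestronglyMeasurable_const
    have hfun : (fun u => timeAverage doubling k (fourier j : UnitAddCircle → ℂ) N u -
        ∫ y : UnitAddCircle, (fourier j y : ℂ)) = (1 / (N : ℂ)) • fun u : UnitAddCircle =>
          ∑ n ∈ Finset.range N, (fourier (((2 ^ k n : ℕ) : ℤ) * j) u : ℂ) := by
      ext u
      rw [integral_fourier, if_neg hj]
      simp only [timeAverage, doubling_iterate, fourier_nsmul, sub_zero, Pi.smul_apply, smul_eq_mul]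
    have hmem : MemLp (fun u : UnitAddCircle =>
        ∑ n ∈ Finset.range N, (fourier (((2 ^ k n : ℕ) : ℤ) * j) u : ℂ)) 2 volume :=
      (hcont N).memLp_of_hasCompactSupport (HasCompactSupport.of_compactSpace _)
    rw [hfun, eLpNorm_const_smul,
      hmem.eLpNorm_eq_integral_rpow_norm two_ne_zero ENNReal.ofNat_ne_top,
      ← ofReal_norm, ← ENNReal.ofReal_mul (norm_nonneg _)]
    congr 1
    rw [Real.sqrt_div (integral_nonneg fun u => by positivity), Real.sqrt_sq (Nat.cast_nonneg N),
      Real.sqrt_eq_rpow]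
    simp
    ring
  refine tendsto_of_tendsto_of_tendsto_of_le_of_le tendsto_const_nhds ?_ (fun _ => bot_le) hbound
  have := (tendsto_coincidence_frequency hk).sqrt
  rw [Real.sqrt_zero] at this
  simpa using ENNReal.tendsto_ofReal this

lemma tendsto_averageDeviation_doubling {k : ℕ → ℕ} (hk : UniformlyDistributedInt k)
    {G : UnitAddCircle → ℂ} (hG : Integrable G) :
    Tendsto (averageDeviation doubling k volume G) atTop (𝓝 0) := by
  have hspan := span_fourierLp_closure_eq_top (T := 1) (p := 1) ENNReal.one_ne_top
  have hcoe := fun n => coeFn_fourierLp (T := 1) 1 n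
  revert hspan hcoe
  -- The type of `fourierLp` mentions the Haar measure, so the family is abstracted before that
  -- measure is rewritten as `volume`.
  generalize hF : fourierLp (T := 1) 1 = F
  clear hF
  revert F
  rw [haarAddCircle_one_eq_volume]
  intro F hspan hcoe
  refine tendsto_averageDeviation_of_dense measurePreserving_doubling _ hspan ?_ hG
  rintro _ ⟨n, rfl⟩
  refine (tendsto_averageDeviation_fourier hk n).congr fun N => ?_
  exact (averageDeviation_congr_ae measurePreserving_doubling (hcoe n) N).symm

lemma ae_tendsto_timeAverage_doubling {p : ENNReal} (hp : 1 ≤ p) {k : ℕ → ℕ}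
    (hgood : IsGoodUniversal p k) (hk : UniformlyDistributedInt k) {G : UnitAddCircle → ℂ}
    (hG : MemLp G p volume) :
    ∀ᵐ u : UnitAddCircle, Tendsto (fun N => timeAverage doubling k G N u) atTop
      (𝓝 (∫ v, G v)) :=
  ae_tendsto_timeAverage_of_exists_limit measurePreserving_doubling (hG.integrable hp)
    (tendsto_averageDeviation_doubling hk (hG.integrable hp))
    (hgood UnitAddCircle _ volume inferInstance doubling measurePreserving_doubling G hG)

/-! ### A variance estimate for averages along distinct times -/

lemma integrable_of_measurable_bounded {X : Type*} [MeasurableSpace X] {μ : Measure X}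
    [IsFiniteMeasure μ] {F : X → ℝ} (hF : Measurable F) {B : ℝ} (h : ∀ x, |F x| ≤ B) :
    Integrable F μ :=
  Integrable.of_bound hF.aestronglyMeasurable B (Eventually.of_forall h)

lemma card_filter_close_le {k : ℕ → ℕ} (hk : Function.Injective k) (J N a : ℕ) :
    ((Finset.range N).filter fun m => k m < a + J ∧ a < k m + J).card ≤ 2 * J := by
  calc _ ≤ (Finset.Ico (a + 1 - J) (a + J)).card := by
        refine Finset.card_le_card_of_injOn k (fun m hm => ?_) hk.injOn
        simp only [Finset.coe_filter, Finset.mem_range, Set.mem_ofPred_eq] at hm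
        simp only [Finset.coe_Ico, Set.mem_Ico]
        omega
    _ ≤ 2 * J := by rw [Nat.card_Ico]; omega

/-- Expand the square into covariances. Those at gap at least `J` vanish; the others are at most `B`
times the mean. Because the times are distinct, each index has at most `2 * J` close partners, so
the variance is linear in `N`. -/
lemma integral_sq_sum_sub_le {X : Type*} [MeasurableSpace X] {μ : Measure X}
    [IsProbabilityMeasure μ] {T : X → X} (hT : MeasurePreserving T μ μ) {F : X → ℝ}
    (hF : Measurable F) (hF0 : ∀ x, 0 ≤ F x) {B : ℝ} (hFB : ∀ x, F x ≤ B) {J : ℕ}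
    (hmix : ∀ d, J ≤ d → ∫ x, F x * F (T^[d] x) ∂μ = (∫ x, F x ∂μ) ^ 2)
    {k : ℕ → ℕ} (hk : Function.Injective k) (N : ℕ) :
    ∫ x, (∑ n ∈ Finset.range N, F (T^[k n] x) - N * ∫ y, F y ∂μ) ^ 2 ∂μ ≤
      N * (2 * J) * (B * ∫ x, F x ∂μ) := by
  classical
  set m := ∫ x, F x ∂μ with hm
  have hTm : ∀ n, Measurable (T^[n]) := fun n => (hT.iterate n).measurable
  have hm0 : 0 ≤ m := integral_nonneg hF0
  have hB0 : 0 ≤ B := by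
    obtain ⟨x⟩ : Nonempty X := nonempty_of_isProbabilityMeasure μ
    exact (hF0 x).trans (hFB x)
  have hFi : Integrable F μ := integrable_of_measurable_bounded hF (B := B) fun x => by
    rw [abs_of_nonneg (hF0 x)]; exact hFB x
  have hFTi : ∀ n, Integrable (fun x => F (T^[n] x)) μ := fun n =>
    (hT.iterate n).integrable_comp_of_integrable hFi
  have hprod : ∀ a b, Integrable (fun x => F (T^[a] x) * F (T^[b] x)) μ := fun a b =>
    integrable_of_measurable_bounded ((hF.comp (hTm a)).mul (hF.comp (hTm b))) (B := B * B)
      fun x => by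
        rw [abs_of_nonneg (mul_nonneg (hF0 _) (hF0 _))]
        exact mul_le_mul (hFB _) (hFB _) (hF0 _) hB0
  have hint : ∀ n, ∫ x, F (T^[n] x) ∂μ = m := fun n => by
    have h := integral_map (μ := μ) (hTm n).aemeasurable (f := F)
      (by rw [(hT.iterate n).map_eq]; exact hF.aestronglyMeasurable)
    rw [(hT.iterate n).map_eq] at h
    exact h.symm
  have hcov : ∀ a b, ∫ x, (F (T^[a] x) - m) * (F (T^[b] x) - m) ∂μ =
      ∫ x, F (T^[a] x) * F (T^[b] x) ∂μ - m ^ 2 := by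
    intro a b
    have : ∀ x, (F (T^[a] x) - m) * (F (T^[b] x) - m) =
        F (T^[a] x) * F (T^[b] x) - m * F (T^[a] x) - m * F (T^[b] x) + m ^ 2 := fun x => by ring
    simp only [this]
    have h1 : Integrable (fun x => F (T^[a] x) * F (T^[b] x) - m * F (T^[a] x)) μ :=
      (hprod a b).sub ((hFTi a).const_mul m)
    have h2 : Integrable
        (fun x => F (T^[a] x) * F (T^[b] x) - m * F (T^[a] x) - m * F (T^[b] x)) μ :=
      h1.sub ((hFTi b).const_mul m)
    rw [integral_add h2 (integrable_const _), integral_sub h1 ((hFTi b).const_mul m),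
      integral_sub (hprod a b) ((hFTi a).const_mul m), integral_const_mul, integral_const_mul,
      hint, hint]
    simp
    ring
  have hshift : ∀ a d, ∫ x, F (T^[a] x) * F (T^[a + d] x) ∂μ = ∫ x, F x * F (T^[d] x) ∂μ := by
    intro a d
    have hmeas : Measurable fun x => F x * F (T^[d] x) := hF.mul (hF.comp (hTm d))
    have h := integral_map (μ := μ) (hTm a).aemeasurable (f := fun x => F x * F (T^[d] x))
      (by rw [(hT.iterate a).map_eq]; exact hmeas.aestronglyMeasurable)
    rw [(hT.iterate a).map_eq] at h
    rw [h]
    refine integral_congr_ae (Eventually.of_forall fun x => ?_)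
    simp only [← Function.iterate_add_apply, add_comm a d]
  have hfar : ∀ a b, a + J ≤ b → ∫ x, F (T^[a] x) * F (T^[b] x) ∂μ = m ^ 2 := by
    intro a b hab
    obtain ⟨d, rfl⟩ := Nat.exists_eq_add_of_le (show a ≤ b by omega)
    rw [hshift, hmix d (by omega)]
  have hle : ∀ a b, ∫ x, (F (T^[a] x) - m) * (F (T^[b] x) - m) ∂μ ≤
      if b < a + J ∧ a < b + J then B * m else 0 := by
    intro a b
    rw [hcov]
    split_ifs with h
    · have h1 : ∫ x, F (T^[a] x) * F (T^[b] x) ∂μ ≤ ∫ x, B * F (T^[b] x) ∂μ :=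
        integral_mono (hprod a b) ((hFTi b).const_mul B) fun x =>
          mul_le_mul_of_nonneg_right (hFB _) (hF0 _)
      rw [integral_const_mul, hint] at h1
      nlinarith [sq_nonneg m]
    · rcases not_and_or.1 h with h | h
      · rw [hfar a b (by omega), sub_self]
      · simp_rw [mul_comm (F (T^[a] _))]
        rw [hfar b a (by omega), sub_self]
  have hexp : ∀ x, (∑ n ∈ Finset.range N, F (T^[k n] x) - N * m) ^ 2 =
      ∑ i ∈ Finset.range N, ∑ j ∈ Finset.range N,
        (F (T^[k i] x) - m) * (F (T^[k j] x) - m) := by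
    intro x
    rw [← Finset.sum_mul_sum, ← sq, Finset.sum_sub_distrib]
    simp
  have hYi : ∀ a b, Integrable (fun x => (F (T^[a] x) - m) * (F (T^[b] x) - m)) μ := by
    intro a b
    have : ∀ x, (F (T^[a] x) - m) * (F (T^[b] x) - m) =
        F (T^[a] x) * F (T^[b] x) - m * F (T^[a] x) - m * F (T^[b] x) + m ^ 2 := fun x => by ring
    simp only [this]
    exact (((hprod a b).sub ((hFTi a).const_mul m)).sub ((hFTi b).const_mul m)).add
      (integrable_const _)
  simp only [hexp]
  rw [integral_finsetSum _ fun i _ => integrable_finsetSum _ fun j _ => hYi _ _]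
  calc _ ≤ ∑ i ∈ Finset.range N, (2 * J : ℝ) * (B * m) := by
        refine Finset.sum_le_sum fun i _ => ?_
        rw [integral_finsetSum _ fun j _ => hYi _ _]
        refine (Finset.sum_le_sum fun j _ => hle (k i) (k j)).trans ?_
        rw [← Finset.sum_filter, Finset.sum_const, nsmul_eq_mul]
        refine mul_le_mul_of_nonneg_right ?_ (mul_nonneg hB0 hm0)
        exact_mod_cast card_filter_close_le hk J N (k i)
    _ = _ := by simp; ring

/-! ### Dyadic balls around the origin of the circle -/

/-- The arc of radius `2⁻ʲ` around the origin. -/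
def dyadicBall (j : ℕ) : Set UnitAddCircle := Metric.closedBall 0 ((1 / 2) ^ j)

lemma mem_dyadicBall {j : ℕ} {u : UnitAddCircle} : u ∈ dyadicBall j ↔ ‖u‖ ≤ (1 / 2) ^ j := by
  simp [dyadicBall]

lemma measurableSet_dyadicBall (j : ℕ) : MeasurableSet (dyadicBall j) :=
  Metric.isClosed_closedBall.measurableSet

lemma volume_dyadicBall_le (j : ℕ) :
    volume (dyadicBall j) ≤ ENNReal.ofReal (2 * (1 / 2) ^ j) := by
  rw [dyadicBall, AddCircle.volume_closedBall]
  exact ENNReal.ofReal_le_ofReal (min_le_right _ _)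

/-- Multiplication by `2 ^ d` wraps the arc around the circle a whole number of times, so the arc is
exactly independent of `G (2 ^ d • u)`. The condition `1 ≤ j` keeps the arc within one period. -/
lemma integral_dyadicBall_mul_comp {j d : ℕ} (hj : 1 ≤ j) (hd : j ≤ d) {G : UnitAddCircle → ℝ}
    (hG : Integrable G) :
    ∫ u, (dyadicBall j).indicator (fun _ => (1 : ℝ)) u * G (2 ^ d • u) =
      2 * (1 / 2) ^ j * ∫ u, G u := by
  obtain ⟨e, rfl⟩ := Nat.exists_eq_add_of_le hd
  set r : ℝ := (1 / 2) ^ j with hr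
  have hr0 : 0 < r := by positivity
  have hr2 : r ≤ 1 / 2 := by
    calc r ≤ (1 / 2) ^ 1 := pow_le_pow_of_le_one (by norm_num) (by norm_num) hj
      _ = 1 / 2 := pow_one _
  set g : ℝ → ℝ := fun x => G x with hg
  have hper : Function.Periodic g 1 := fun x => by simp [g]
  have hgi : ∀ t : ℝ, IntervalIntegrable g volume t (t + 1) := by
    intro t
    rw [intervalIntegrable_iff_integrableOn_Ioc_of_le (by linarith)]
    exact (UnitAddCircle.measurePreserving_mk t).integrable_comp_of_integrable hG
  have hgi' : ∀ a b : ℝ, IntervalIntegrable g volume a b := fun a b =>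
    hper.intervalIntegrable (t := 0) one_ne_zero (hgi 0) a b
  rw [← UnitAddCircle.intervalIntegral_preimage (-(1 / 2)), show (-(1 / 2) + 1 : ℝ) = 1 / 2 by norm_num,
    ← UnitAddCircle.intervalIntegral_preimage (0 : ℝ) G]
  have h1 : ∫ x in (-(1 / 2) : ℝ)..(1 / 2), (dyadicBall j).indicator (fun _ => (1 : ℝ))
        (x : UnitAddCircle) * G (2 ^ (j + e) • (x : UnitAddCircle)) =
      ∫ x in (-(1 / 2) : ℝ)..(1 / 2), (Set.Icc (-r) r).indicator
        (fun x => g (2 ^ (j + e) * x)) x := by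
    refine intervalIntegral.integral_congr fun x hx => ?_
    rw [Set.uIcc_of_le (by norm_num)] at hx
    have hn : ‖(x : UnitAddCircle)‖ = |x| :=
      (AddCircle.norm_coe_eq_abs_iff 1 one_ne_zero).2 (by rw [abs_one, abs_le]; exact hx)
    have hmul : 2 ^ (j + e) • (x : UnitAddCircle) = ((2 ^ (j + e) * x : ℝ) : UnitAddCircle) := by
      rw [← AddCircle.coe_nsmul]; simp
    by_cases hxr : |x| ≤ r
    · rw [Set.indicator_of_mem (mem_dyadicBall.2 (hn.trans_le hxr)),
        Set.indicator_of_mem (Set.mem_Icc.2 (abs_le.1 hxr)), hmul, one_mul]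
    · rw [Set.indicator_of_notMem fun h => hxr (hn.symm.trans_le (mem_dyadicBall.1 h)),
        Set.indicator_of_notMem fun h => hxr (abs_le.2 (Set.mem_Icc.1 h)), zero_mul]
  have h2 : ∫ x in (-(1 / 2) : ℝ)..(1 / 2), (Set.Icc (-r) r).indicator
        (fun x => g (2 ^ (j + e) * x)) x = ∫ x in (-r)..r, g (2 ^ (j + e) * x) := by
    rw [intervalIntegral.integral_of_le (by norm_num), intervalIntegral.integral_of_le (by linarith),
      ← integral_Icc_eq_integral_Ioc, ← integral_Icc_eq_integral_Ioc,
      setIntegral_indicator measurableSet_Icc]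
    congr 2
    rw [Set.inter_eq_right]
    exact Set.Icc_subset_Icc (by linarith) hr2
  rw [h1, h2, intervalIntegral.integral_comp_mul_left (fun x => g x) (by positivity)]
  have hre : (2 : ℝ) ^ (j + e) * r = 2 ^ e := by
    rw [hr, pow_add, mul_right_comm, ← mul_pow]; simp
  -- After rescaling, the interval from `-2 ^ e` to `2 ^ e` consists of `2 * 2 ^ e` full periods.
  have h3 := hper.intervalIntegral_add_zsmul_eq (2 * 2 ^ e) (-2 ^ e) hgi'
  rw [show ((2 : ℝ) ^ (j + e) * -r) = -2 ^ e by rw [mul_neg, hre], hre]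
  have h4 : (-2 ^ e + (2 * 2 ^ e : ℤ) • (1 : ℝ) : ℝ) = 2 ^ e := by
    simp; ring
  rw [h4] at h3
  rw [h3, hper.intervalIntegral_add_eq (-2 ^ e) 0]
  have h5 : ((2 : ℝ) ^ (j + e))⁻¹ * (2 * 2 ^ e) = 2 * r := by
    rw [← hre]; field_simp
  simp only [zsmul_eq_mul, smul_eq_mul]
  rw [← mul_assoc]
  congr 1
  rw [← h5]; push_cast; ring

/-- A step function that dominates functions growing like `θ ^ j` at distance `2⁻ʲ` from the
origin, restricted to the scales `M ≤ j < J`. -/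
noncomputable def dyadicLayers (C θ : ℝ) (M J : ℕ) (u : UnitAddCircle) : ℝ :=
  ∑ j ∈ Finset.Ico M J, C * θ ^ (j + 1) * (dyadicBall j).indicator (fun _ => (1 : ℝ)) u

section Layers

variable {C θ : ℝ} {M J : ℕ}

lemma measurable_dyadicLayers : Measurable (dyadicLayers C θ M J) :=
  Finset.measurable_fun_sum _ fun j _ =>
    (measurable_const.indicator (measurableSet_dyadicBall j)).const_mul _

lemma indicator_one_le_one {X : Type*} (s : Set X) (x : X) :
    s.indicator (fun _ => (1 : ℝ)) x ≤ 1 :=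
  Set.indicator_le_self' (fun _ _ => zero_le_one) x

lemma indicator_one_nonneg {X : Type*} (s : Set X) (x : X) :
    0 ≤ s.indicator (fun _ => (1 : ℝ)) x :=
  Set.indicator_nonneg (fun _ _ => zero_le_one) x

lemma dyadicLayers_nonneg (hC : 0 ≤ C) (hθ : 0 ≤ θ) (u : UnitAddCircle) :
    0 ≤ dyadicLayers C θ M J u :=
  Finset.sum_nonneg fun j _ => mul_nonneg (by positivity) (indicator_one_nonneg _ u)

lemma dyadicLayers_le (hC : 0 ≤ C) (hθ : 1 ≤ θ) (u : UnitAddCircle) :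
    dyadicLayers C θ M J u ≤ J * (C * θ ^ J) := by
  have h0 : 0 ≤ θ := zero_le_one.trans hθ
  calc dyadicLayers C θ M J u ≤ ∑ j ∈ Finset.Ico M J, C * θ ^ J := by
        refine Finset.sum_le_sum fun j hj => ?_
        have hj' : j + 1 ≤ J := (Finset.mem_Ico.1 hj).2
        calc _ ≤ C * θ ^ (j + 1) * 1 :=
              mul_le_mul_of_nonneg_left (indicator_one_le_one _ u) (by positivity)
          _ ≤ C * θ ^ J := by
            rw [mul_one]
            exact mul_le_mul_of_nonneg_left (pow_le_pow_right₀ hθ hj') hC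
    _ = ((J - M : ℕ) : ℝ) * (C * θ ^ J) := by simp
    _ ≤ J * (C * θ ^ J) := by
      refine mul_le_mul_of_nonneg_right ?_ (by positivity)
      exact_mod_cast Nat.sub_le J M

lemma integrable_dyadicBall_mul {j : ℕ} {G : UnitAddCircle → ℝ} (hG : Integrable G) (c : ℝ) :
    Integrable fun u => c * (dyadicBall j).indicator (fun _ => (1 : ℝ)) u * G u := by
  have : (fun u => c * (dyadicBall j).indicator (fun _ => (1 : ℝ)) u * G u) =
      fun u => c * (dyadicBall j).indicator G u := by
    ext u
    by_cases hu : u ∈ dyadicBall j <;> simp [hu]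
  rw [this]
  exact (hG.indicator (measurableSet_dyadicBall j)).const_mul c

lemma integral_dyadicLayers_mul_comp (hM : 1 ≤ M) {d : ℕ} (hd : J ≤ d) {G : UnitAddCircle → ℝ}
    (hG : Integrable G) :
    ∫ u, dyadicLayers C θ M J u * G (2 ^ d • u) =
      (∑ j ∈ Finset.Ico M J, C * θ ^ (j + 1) * (2 * (1 / 2) ^ j)) * ∫ u, G u := by
  have hGd : Integrable fun u : UnitAddCircle => G (2 ^ d • u) := by
    have := (measurePreserving_doubling.iterate d).integrable_comp_of_integrable hG
    simpa [Function.comp_def, doubling_iterate] using this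
  simp only [dyadicLayers, Finset.sum_mul]
  rw [integral_finsetSum _ fun j _ => integrable_dyadicBall_mul hGd _]
  refine Finset.sum_congr rfl fun j hj => ?_
  rw [Finset.mem_Ico] at hj
  simp only [mul_assoc (C * θ ^ (j + 1))]
  rw [integral_const_mul, integral_dyadicBall_mul_comp (hM.trans hj.1) (hj.2.le.trans hd) hG]

lemma integral_dyadicLayers (hM : 1 ≤ M) :
    ∫ u, dyadicLayers C θ M J u = ∑ j ∈ Finset.Ico M J, C * θ ^ (j + 1) * (2 * (1 / 2) ^ j) := by
  simpa using integral_dyadicLayers_mul_comp (C := C) (θ := θ) hM le_rfl (G := fun _ => 1)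
    (integrable_const _)

/-- Height `θ ^ (j + 1)` on length `2 * 2⁻ʲ` gives a geometric series of ratio `θ / 2`. The bound
does not depend on `J` and is small when `M` is large. -/
lemma integral_dyadicLayers_le (hM : 1 ≤ M) (hC : 0 ≤ C) (hθ : 0 ≤ θ) (hθ2 : θ < 2) :
    ∫ u, dyadicLayers C θ M J u ≤ 2 * C * θ * ((θ / 2) ^ M / (1 - θ / 2)) := by
  rw [integral_dyadicLayers hM]
  calc _ = 2 * C * θ * ∑ j ∈ Finset.Ico M J, (θ / 2) ^ j := by
        rw [Finset.mul_sum]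
        refine Finset.sum_congr rfl fun j _ => ?_
        rw [div_pow, div_pow, one_pow, pow_succ]; ring
    _ ≤ _ := mul_le_mul_of_nonneg_left
        (geom_sum_Ico_le_of_lt_one (by positivity) (by linarith)) (by positivity)

lemma integral_sq_sum_dyadicLayers_sub_le (hM : 1 ≤ M) (hC : 0 ≤ C) (hθ : 1 ≤ θ) {k : ℕ → ℕ}
    (hk : Function.Injective k) (N : ℕ) :
    ∫ u, (∑ n ∈ Finset.range N, dyadicLayers C θ M J (doubling^[k n] u) -
        N * ∫ v, dyadicLayers C θ M J v) ^ 2 ≤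
      N * (2 * J) * (J * (C * θ ^ J) * ∫ v, dyadicLayers C θ M J v) := by
  have h0 : 0 ≤ θ := zero_le_one.trans hθ
  refine integral_sq_sum_sub_le measurePreserving_doubling measurable_dyadicLayers
    (dyadicLayers_nonneg hC h0) (dyadicLayers_le hC hθ) (fun d hd => ?_) hk N
  have hi : Integrable (dyadicLayers C θ M J) :=
    integrable_of_measurable_bounded measurable_dyadicLayers fun u => by
      rw [abs_of_nonneg (dyadicLayers_nonneg hC h0 u)]; exact dyadicLayers_le hC hθ u
  simp only [doubling_iterate]
  rw [integral_dyadicLayers_mul_comp hM hd hi, ← integral_dyadicLayers hM, sq]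

lemma exists_dyadic_scale {u : UnitAddCircle} (hM : u ∈ dyadicBall M) (hJ : u ∉ dyadicBall J) :
    ∃ j ∈ Finset.Ico M J, u ∈ dyadicBall j ∧ u ∉ dyadicBall (j + 1) := by
  by_contra! h
  have hle : M ≤ J := by
    by_contra! hlt
    refine hJ (mem_dyadicBall.2 ((mem_dyadicBall.1 hM).trans ?_))
    exact pow_le_pow_of_le_one (by norm_num) (by norm_num) hlt.le
  refine hJ (Nat.le_induction (P := fun j _ => j ≤ J → u ∈ dyadicBall j) (fun _ => hM)
    (fun j hj ih hjJ => h j (Finset.mem_Ico.2 ⟨hj, hjJ⟩) (ih (by omega))) J hle le_rfl)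

/-- A point between radii `2⁻ʲ` and `2⁻ʲ⁻¹` is already dominated by the single layer `j`. Only the
innermost ball, of index `J`, escapes the bound. -/
lemma indicator_le_dyadicLayers (hC : 0 ≤ C) (hθ : 0 ≤ θ) {W : UnitAddCircle → ℝ}
    (hW : ∀ j u, u ∉ dyadicBall (j + 1) → W u ≤ C * θ ^ (j + 1)) {u : UnitAddCircle}
    (hJ : u ∉ dyadicBall J) : (dyadicBall M).indicator W u ≤ dyadicLayers C θ M J u := by
  by_cases hM : u ∈ dyadicBall M
  · obtain ⟨j, hj, hu, hu'⟩ := exists_dyadic_scale hM hJ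
    rw [Set.indicator_of_mem hM]
    calc W u ≤ C * θ ^ (j + 1) * (dyadicBall j).indicator (fun _ => (1 : ℝ)) u := by
          rw [Set.indicator_of_mem hu, mul_one]; exact hW j u hu'
      _ ≤ _ := Finset.single_le_sum
        (f := fun j => C * θ ^ (j + 1) * (dyadicBall j).indicator (fun _ => (1 : ℝ)) u)
        (fun i _ => mul_nonneg (by positivity) (indicator_one_nonneg _ u)) hj
  · rw [Set.indicator_of_notMem hM]
    exact dyadicLayers_nonneg hC hθ u

end Layers

/-! ### Averages near the singularity -/

/-- With `N = 2 ^ (b * r)` and `J = (b + 1) * r`, this makes the layer height `θ ^ J` exponentially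
smaller than `N`, while `N * 2⁻ᴶ = 2⁻ʳ` is still summable. -/
lemma exists_pow_succ_lt_two_pow {θ : ℝ} (hθ : 0 ≤ θ) (hθ2 : θ < 2) :
    ∃ b : ℕ, 1 ≤ b ∧ θ ^ (b + 1) < 2 ^ b := by
  obtain ⟨n, hn⟩ := exists_pow_lt_of_lt_one (show (0 : ℝ) < 1 / 2 by norm_num)
    (show θ / 2 < 1 by linarith)
  refine ⟨n + 1, by omega, ?_⟩
  have h : (θ / 2) ^ (n + 2) < 1 / 2 :=
    (pow_le_pow_of_le_one (by positivity) (by linarith) (by omega)).trans_lt hn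
  rw [div_pow, div_lt_iff₀ (by positivity)] at h
  calc θ ^ (n + 1 + 1) < 1 / 2 * 2 ^ (n + 2) := h
    _ = 2 ^ (n + 1) := by ring

/-- Borel–Cantelli: `2 ^ (b * r)` preimages, each of measure at most `2 * 2 ^ (-(b + 1) * r)`, have
total measure at most `2 * 2⁻ʳ`. -/
lemma ae_eventually_forall_notMem_dyadicBall (k : ℕ → ℕ) (b : ℕ) :
    ∀ᵐ u : UnitAddCircle, ∀ᶠ r : ℕ in atTop, ∀ n < (2 ^ b) ^ r,
      doubling^[k n] u ∉ dyadicBall ((b + 1) * r) := by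
  have hle : ∀ r : ℕ, volume (⋃ n ∈ Finset.range ((2 ^ b) ^ r),
      doubling^[k n] ⁻¹' dyadicBall ((b + 1) * r)) ≤ ENNReal.ofReal (2 * (1 / 2) ^ r) := by
    intro r
    refine (measure_biUnion_finset_le _ _).trans ?_
    calc _ ≤ ∑ n ∈ Finset.range ((2 ^ b) ^ r), ENNReal.ofReal (2 * (1 / 2) ^ ((b + 1) * r)) := by
          refine Finset.sum_le_sum fun n _ => ?_
          rw [(measurePreserving_doubling.iterate (k n)).measure_preimage
            (measurableSet_dyadicBall _).nullMeasurableSet]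
          exact volume_dyadicBall_le _
      _ = ENNReal.ofReal (2 * (1 / 2) ^ r) := by
        rw [Finset.sum_const, Finset.card_range, nsmul_eq_mul, ← ENNReal.ofReal_natCast,
          ← ENNReal.ofReal_mul (by positivity)]
        congr 1
        push_cast
        rw [add_mul, one_mul, pow_add, ← pow_mul, one_div, inv_pow, inv_pow]
        field_simp
  have hsum : ∑' r : ℕ, volume (⋃ n ∈ Finset.range ((2 ^ b) ^ r),
      doubling^[k n] ⁻¹' dyadicBall ((b + 1) * r)) ≠ ⊤ := by
    refine ne_top_of_le_ne_top ?_ (ENNReal.tsum_le_tsum hle)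
    exact ((summable_geometric_of_lt_one (by norm_num) (by norm_num)).mul_left 2).tsum_ofReal_ne_top
  filter_upwards [ae_eventually_notMem hsum] with u hu
  filter_upwards [hu] with r hr n hn
  simp only [Set.mem_iUnion, not_exists] at hr
  exact hr n (Finset.mem_range.2 hn)

/-- Chebyshev applied to a variance of order `N J² θ ^ J` bounds the exceptional sets by a multiple
of `r² ρ ^ r` with `ρ = θ ^ (b + 1) / 2 ^ b < 1`. Borel–Cantelli then applies. -/
lemma ae_eventually_sum_dyadicLayers_le {C θ : ℝ} (hC : 0 < C) (hθ : 1 < θ) (hθ2 : θ < 2) {b : ℕ}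
    (hb : θ ^ (b + 1) < 2 ^ b) {k : ℕ → ℕ} (hk : Function.Injective k) {M : ℕ} (hM : 1 ≤ M) :
    ∀ᵐ u : UnitAddCircle, ∀ᶠ r : ℕ in atTop,
      ∑ n ∈ Finset.range ((2 ^ b) ^ r), dyadicLayers C θ M ((b + 1) * r) (doubling^[k n] u) ≤
        (2 ^ b) ^ r * (2 * (2 * C * θ * ((θ / 2) ^ M / (1 - θ / 2)))) := by
  set E : ℝ := 2 * C * θ * ((θ / 2) ^ M / (1 - θ / 2)) with hE
  have hθ0 : 0 < θ := by linarith
  have hE0 : 0 < E := by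
    have : 0 < 1 - θ / 2 := by linarith
    positivity
  set S : ℕ → UnitAddCircle → ℝ := fun r u => ∑ n ∈ Finset.range ((2 ^ b) ^ r),
    dyadicLayers C θ M ((b + 1) * r) (doubling^[k n] u) with hS
  set m : ℕ → ℝ := fun r => ∫ v, dyadicLayers C θ M ((b + 1) * r) v with hm
  have hmE : ∀ r, m r ≤ E := fun r => integral_dyadicLayers_le hM hC.le hθ0.le hθ2
  have hm0 : ∀ r, 0 ≤ m r := fun r => integral_nonneg (dyadicLayers_nonneg hC.le hθ0.le)
  have hS0 : ∀ r u, 0 ≤ S r u := fun r u =>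
    Finset.sum_nonneg fun n _ => dyadicLayers_nonneg hC.le hθ0.le _
  have hSm : ∀ r, Measurable (S r) := fun r => Finset.measurable_fun_sum _ fun n _ =>
    measurable_dyadicLayers.comp (measurePreserving_doubling.iterate (k n)).measurable
  have hSB : ∀ r u, S r u ≤ ((2 ^ b) ^ r : ℕ) *
      (((b + 1) * r : ℕ) * (C * θ ^ ((b + 1) * r))) := by
    intro r u
    refine (Finset.sum_le_card_nsmul _ _ _ fun n _ => dyadicLayers_le hC.le hθ.le _).trans ?_
    rw [Finset.card_range, nsmul_eq_mul]
  have hint : ∀ r, Integrable fun u => (S r u - ((2 ^ b) ^ r : ℕ) * m r) ^ 2 := by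
    intro r
    refine integrable_of_measurable_bounded (((hSm r).sub_const _).pow_const 2)
      (B := (((2 ^ b) ^ r : ℕ) * (((b + 1) * r : ℕ) * (C * θ ^ ((b + 1) * r))) +
        ((2 ^ b) ^ r : ℕ) * m r) ^ 2) fun u => ?_
    rw [abs_of_nonneg (sq_nonneg _)]
    have h1 := hS0 r u
    have h2 := hSB r u
    have h3 : 0 ≤ (((2 ^ b) ^ r : ℕ) : ℝ) * m r := mul_nonneg (Nat.cast_nonneg _) (hm0 r)
    apply sq_le_sq'
    · linarith [h1.trans h2]
    · linarith
  set ρ : ℝ := θ ^ (b + 1) / 2 ^ b with hρ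
  have hρ1 : ρ < 1 := (div_lt_one (by positivity)).2 hb
  have hρ0 : 0 ≤ ρ := by positivity
  -- The threshold uses `E` rather than the mean `m r`: `E` is positive and independent of `r`,
  -- while `m r` vanishes as long as there are no layers. Mean plus deviation gives the factor `2 *
  -- E`.
  set bad : ℕ → Set UnitAddCircle := fun r =>
    {u | (((2 ^ b) ^ r : ℕ) * E) ^ 2 ≤ (S r u - ((2 ^ b) ^ r : ℕ) * m r) ^ 2} with hbad
  have hle : ∀ r, volume (bad r) ≤
      ENNReal.ofReal (2 * C * (b + 1) ^ 2 / E * ((r : ℝ) ^ 2 * ρ ^ r)) := by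
    intro r
    rw [← ofReal_measureReal]
    refine ENNReal.ofReal_le_ofReal ?_
    have h1 := mul_meas_ge_le_integral_of_nonneg (μ := volume)
      (Eventually.of_forall fun u => sq_nonneg (S r u - ((2 ^ b) ^ r : ℕ) * m r)) (hint r)
      ((((2 ^ b) ^ r : ℕ) * E) ^ 2)
    have h2 := h1.trans (integral_sq_sum_dyadicLayers_sub_le (J := (b + 1) * r) hM hC.le hθ.le hk
      ((2 ^ b) ^ r))
    have hN : (0 : ℝ) < ((2 ^ b) ^ r : ℕ) := by positivity
    have hNr : (((2 ^ b) ^ r : ℕ) : ℝ) * ρ ^ r = θ ^ ((b + 1) * r) := by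
      rw [hρ, div_pow, ← pow_mul θ]; push_cast; field_simp
    have h3 : (((2 ^ b) ^ r : ℕ) * E) ^ 2 * volume.real (bad r) ≤
        ((2 ^ b) ^ r : ℕ) * (2 * ((b + 1) * r : ℕ)) *
          (((b + 1) * r : ℕ) * (C * θ ^ ((b + 1) * r)) * E) := by
      refine h2.trans ?_
      gcongr
      exact hmE r
    rw [← hNr] at h3
    generalize (((2 ^ b) ^ r : ℕ) : ℝ) = N at h3 hN
    have h4 : (N * E) ^ 2 * volume.real (bad r) ≤
        (N * E) ^ 2 * (2 * C * (b + 1) ^ 2 / E * ((r : ℝ) ^ 2 * ρ ^ r)) := by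
      refine h3.trans (le_of_eq ?_)
      push_cast
      field_simp
    exact le_of_mul_le_mul_left h4 (by positivity)
  have hsum : ∑' r : ℕ, volume (bad r) ≠ ⊤ := by
    refine ne_top_of_le_ne_top ?_ (ENNReal.tsum_le_tsum hle)
    refine (Summable.mul_left _ ?_).tsum_ofReal_ne_top
    exact summable_pow_mul_geometric_of_norm_lt_one 2 (by rwa [Real.norm_of_nonneg hρ0])
  filter_upwards [ae_eventually_notMem hsum] with u hu
  filter_upwards [hu] with r hr
  simp only [hbad, Set.mem_ofPred_eq, not_le] at hr
  have hN : (0 : ℝ) < ((2 ^ b) ^ r : ℕ) := by positivity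
  have h1 := (abs_lt.1 (abs_lt_of_sq_lt_sq hr (by positivity))).2
  have h2 := mul_le_mul_of_nonneg_left (hmE r) hN.le
  have h3 : S r u ≤ (((2 ^ b) ^ r : ℕ) : ℝ) * (2 * E) := by linarith
  simpa [hS] using h3

/-- Along distinct times, averages of a function with a tame singularity at the origin are
uniformly small when the function is restricted to small arcs around the origin. -/
lemma ae_eventually_average_indicator_le {C θ : ℝ} (hC : 0 < C) (hθ : 1 < θ) (hθ2 : θ < 2)
    {W : UnitAddCircle → ℝ} (hW0 : ∀ u, 0 ≤ W u)
    (hW : ∀ j u, u ∉ dyadicBall (j + 1) → W u ≤ C * θ ^ (j + 1))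
    {k : ℕ → ℕ} (hk : Function.Injective k) :
    ∃ K : ℝ, ∀ M : ℕ, 1 ≤ M → ∀ᵐ u : UnitAddCircle, ∀ᶠ N : ℕ in atTop,
      (1 / (N : ℝ)) * ∑ n ∈ Finset.range N, (dyadicBall M).indicator W (doubling^[k n] u) ≤
        K * (θ / 2) ^ M := by
  have hθ0 : 0 < θ := by linarith
  obtain ⟨b, hb1, hb⟩ := exists_pow_succ_lt_two_pow hθ0.le hθ2
  refine ⟨2 ^ b * (4 * C * θ / (1 - θ / 2)), fun M hM => ?_⟩
  filter_upwards [ae_eventually_forall_notMem_dyadicBall k b,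
    ae_eventually_sum_dyadicLayers_le hC hθ hθ2 hb hk hM] with u hu1 hu2
  have hA : 1 < 2 ^ b := Nat.one_lt_two_pow (by omega)
  have hlog : Tendsto (fun N : ℕ => Nat.log (2 ^ b) N + 1) atTop atTop := by
    refine tendsto_atTop.2 fun r => ?_
    filter_upwards [eventually_ge_atTop ((2 ^ b) ^ r)] with N hN
    have := Nat.log_mono_right (b := 2 ^ b) hN
    rw [Nat.log_pow hA] at this
    omega
  filter_upwards [hlog.eventually (hu1.and hu2), eventually_gt_atTop 0] with N ⟨h1, h2⟩ hN
  -- `(2 ^ b) ^ r` is the first power of `2 ^ b` beyond `N`. As the summands are nonnegative,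
  -- extending the sum up to it costs only a factor `2 ^ b`.
  set r := Nat.log (2 ^ b) N + 1 with hr
  have hNr : N < (2 ^ b) ^ r := Nat.lt_pow_succ_log_self hA N
  have hrN : (2 ^ b) ^ r ≤ 2 ^ b * N := by
    rw [hr, pow_succ, mul_comm]
    exact Nat.mul_le_mul_left _ (Nat.pow_log_le_self _ hN.ne')
  have hrN' : ((2 : ℝ) ^ b) ^ r ≤ 2 ^ b * N := by exact_mod_cast hrN
  have hsum : ∑ n ∈ Finset.range N, (dyadicBall M).indicator W (doubling^[k n] u) ≤
      2 ^ b * N * (2 * (2 * C * θ * ((θ / 2) ^ M / (1 - θ / 2)))) := by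
    calc _ ≤ ∑ n ∈ Finset.range ((2 ^ b) ^ r),
            (dyadicBall M).indicator W (doubling^[k n] u) :=
          Finset.sum_le_sum_of_subset_of_nonneg (Finset.range_subset_range.2 hNr.le)
            fun n _ _ => Set.indicator_nonneg (fun v _ => hW0 v) _
      _ ≤ ∑ n ∈ Finset.range ((2 ^ b) ^ r),
            dyadicLayers C θ M ((b + 1) * r) (doubling^[k n] u) :=
          Finset.sum_le_sum fun n hn =>
            indicator_le_dyadicLayers hC.le hθ0.le hW (h1 n (Finset.mem_range.1 hn))
      _ ≤ _ := h2
      _ ≤ _ := by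
        refine mul_le_mul_of_nonneg_right hrN' ?_
        have : 0 < 1 - θ / 2 := by linarith
        positivity
  have hN' : (0 : ℝ) < N := by exact_mod_cast hN
  rw [one_div, inv_mul_le_iff₀ hN']
  refine hsum.trans (le_of_eq ?_)
  ring

/-- Pointwise convergence along distinct good times for a function with a tame singularity. -/
lemma ae_tendsto_timeAverage_of_injective {p : ENNReal} (hp : 1 ≤ p) {k : ℕ → ℕ}
    (hgood : IsGoodUniversal p k) (hud : UniformlyDistributedInt k) (hk : Function.Injective k)
    {C θ : ℝ} (hC : 0 < C) (hθ : 1 < θ) (hθ2 : θ < 2) {G : UnitAddCircle → ℂ} (hG : Integrable G)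
    (hGb : ∀ j u, u ∉ dyadicBall (j + 1) → ‖G u‖ ≤ C * θ ^ (j + 1)) :
    ∀ᵐ u : UnitAddCircle, Tendsto (fun N => timeAverage doubling k G N u) atTop
      (𝓝 (∫ v, G v)) := by
  obtain ⟨K, hK⟩ := ae_eventually_average_indicator_le hC hθ hθ2 (fun u => norm_nonneg (G u)) hGb hk
  -- The truncations are bounded, hence in `L^p` for every `p`, so good universality applies to them
  -- even when `G` is not in `L^p`.
  set F : ℕ → UnitAddCircle → ℂ := fun M => ((dyadicBall (M + 1))ᶜ).indicator G with hF
  have hFm : ∀ M, AEStronglyMeasurable (F M) volume := fun M =>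
    hG.1.indicator (measurableSet_dyadicBall _).compl
  have hFb : ∀ M u, ‖F M u‖ ≤ C * θ ^ (M + 1) := by
    intro M u
    by_cases hu : u ∈ dyadicBall (M + 1)
    · simp only [hF]
      rw [Set.indicator_of_notMem (Set.notMem_compl_iff.2 hu), norm_zero]
      positivity
    · simp only [hF]
      rw [Set.indicator_of_mem hu]
      exact hGb M u hu
  have hFp : ∀ M, MemLp (F M) p volume := fun M =>
    MemLp.of_bound (hFm M) (C * θ ^ (M + 1)) (Eventually.of_forall (hFb M))
  have hFconv := ae_all_iff.2 fun M => ae_tendsto_timeAverage_doubling hp hgood hud (hFp M)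
  have hint : Tendsto (fun M => ∫ u, F M u) atTop (𝓝 (∫ u, G u)) := by
    refine tendsto_integral_of_dominated_convergence (fun u => ‖G u‖) hFm hG.norm
      (fun M => Eventually.of_forall fun u => norm_indicator_le_norm_self _ _) ?_
    have h0 : ∀ᵐ u : UnitAddCircle, u ≠ 0 := by
      have : volume ({0} : Set UnitAddCircle) = 0 := by
        have h := AddCircle.volume_closedBall 1 (x := (0 : UnitAddCircle)) 0
        simpa using h
      exact measure_eq_zero_iff_ae_notMem.1 this
    filter_upwards [h0] with u hu
    refine tendsto_const_nhds.congr' ?_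
    have hpow : Tendsto (fun M : ℕ => ((1 : ℝ) / 2) ^ (M + 1)) atTop (𝓝 0) :=
      (tendsto_pow_atTop_nhds_zero_of_lt_one (by norm_num) (by norm_num)).comp
        (tendsto_add_atTop_nat 1)
    filter_upwards [hpow.eventually_lt_const (norm_pos_iff.2 hu)] with M hM
    simp only [hF]
    rw [Set.indicator_of_mem]
    exact fun h => absurd (mem_dyadicBall.1 h) (not_le.2 hM)
  have hKM : Tendsto (fun M : ℕ => K * (θ / 2) ^ (M + 1)) atTop (𝓝 0) := by
    have := ((tendsto_pow_atTop_nhds_zero_of_lt_one (show 0 ≤ θ / 2 by linarith)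
      (by linarith)).comp (tendsto_add_atTop_nat 1)).const_mul K
    simpa using this
  filter_upwards [hFconv, ae_all_iff.2 fun M => hK (M + 1) (by omega)] with u hu1 hu2
  refine Metric.tendsto_atTop'.2 fun ε hε => ?_
  obtain ⟨M, hM1, hM2⟩ := ((Metric.tendsto_nhds.1 hint (ε / 3) (by positivity)).and
    (hKM.eventually_lt_const (show 0 < ε / 3 by positivity))).exists
  have hev := ((Metric.tendsto_nhds.1 (hu1 M) (ε / 3) (by positivity)).and (hu2 M))
  obtain ⟨N₀, hN₀⟩ := eventually_atTop.1 hev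
  refine ⟨N₀, fun N hN => ?_⟩
  obtain ⟨h1, h2⟩ := hN₀ N hN.le
  have hsplit : G = F M + (dyadicBall (M + 1)).indicator G :=
    (Set.indicator_compl_add_self _ _).symm
  have h3 : ‖timeAverage doubling k ((dyadicBall (M + 1)).indicator G) N u‖ < ε / 3 := by
    refine (norm_timeAverage_le _ _ _).trans_lt (lt_of_le_of_lt ?_ hM2)
    simpa only [norm_indicator_eq_indicator_norm] using h2
  have h4 : dist (timeAverage doubling k G N u) (timeAverage doubling k (F M) N u) < ε / 3 := by
    rw [dist_eq_norm]
    conv_lhs => rw [hsplit, timeAverage_add, add_sub_cancel_left]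
    exact h3
  calc _ ≤ _ := dist_triangle4 _ _ _ _
    _ < ε / 3 + ε / 3 + ε / 3 := add_lt_add (add_lt_add h4 h1) hM1
    _ = ε := by ring

/-! ### The Boole map is conjugate to the doubling map -/

/-- The angular coordinate on the line, with values in `(0, 1)`. -/
noncomputable def lineAngle (α β x : ℝ) : ℝ := 1 / 2 - Real.arctan ((x - β) / α) / Real.pi

/-- The embedding of the line into the circle by the angular coordinate. -/
noncomputable def lineToCircle (α β x : ℝ) : UnitAddCircle := (lineAngle α β x : ℝ)

/-- The inverse of the angular coordinate. -/
noncomputable def circleToLine (α β : ℝ) (u : UnitAddCircle) : ℝ :=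
  β + α * Real.tan (Real.pi / 2 - Real.pi * (AddCircle.equivIco 1 0 u : ℝ))

section Conjugacy

variable {α β : ℝ}

lemma lineAngle_mem_Ioo (x : ℝ) : lineAngle α β x ∈ Set.Ioo 0 1 := by
  have hπ := Real.pi_pos
  have h1 := Real.arctan_lt_pi_div_two ((x - β) / α)
  have h2 := Real.neg_pi_div_two_lt_arctan ((x - β) / α)
  unfold lineAngle
  constructor
  · rw [sub_pos, div_lt_iff₀ hπ]; linarith
  · rw [sub_lt_comm, lt_div_iff₀ hπ]; linarith

lemma measurable_lineAngle : Measurable (lineAngle α β) :=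
  ((Real.measurable_arctan.comp ((measurable_id.sub_const β).div_const α)).div_const _).const_sub _

lemma measurable_lineToCircle : Measurable (lineToCircle α β) :=
  AddCircle.measurable_mk'.comp measurable_lineAngle

lemma measurable_circleToLine : Measurable (circleToLine α β) := by
  have h1 : Measurable fun u : UnitAddCircle => (AddCircle.equivIco 1 0 u : ℝ) :=
    measurable_subtype_coe.comp (AddCircle.measurableEquivIco 1 0).measurable
  have h2 : Measurable Real.tan := by
    have : Real.tan = fun x => Real.sin x / Real.cos x := funext Real.tan_eq_sin_div_cos
    rw [this]
    exact Real.measurable_sin.div Real.measurable_cos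
  exact ((h2.comp ((h1.const_mul _).const_sub _)).const_mul _).const_add _

lemma tan_lineAngle (hα : 0 < α) (x : ℝ) :
    β + α * Real.tan (Real.pi / 2 - Real.pi * lineAngle α β x) = x := by
  have : Real.pi / 2 - Real.pi * lineAngle α β x = Real.arctan ((x - β) / α) := by
    unfold lineAngle
    have := Real.pi_ne_zero
    field_simp
    ring
  rw [this, Real.tan_arctan]
  field_simp
  ring

lemma circleToLine_lineToCircle (hα : 0 < α) (x : ℝ) :
    circleToLine α β (lineToCircle α β x) = x := by
  have hx := lineAngle_mem_Ioo (α := α) (β := β) x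
  rw [circleToLine, lineToCircle, AddCircle.equivIco_coe_eq (by
    rw [zero_add]; exact Set.Ioo_subset_Ico_self hx)]
  exact tan_lineAngle hα x

lemma range_lineAngle (hα : 0 < α) : Set.range (lineAngle α β) = Set.Ioo 0 1 := by
  refine Set.Subset.antisymm (Set.range_subset_iff.2 lineAngle_mem_Ioo) fun t ht => ?_
  refine ⟨β + α * Real.tan (Real.pi / 2 - Real.pi * t), ?_⟩
  have hπ := Real.pi_pos
  have h0 : 0 < Real.pi * t := mul_pos hπ ht.1
  have h1 : Real.pi * t < Real.pi := by nlinarith [ht.2]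
  rw [lineAngle, add_sub_cancel_left, mul_div_cancel_left₀ _ hα.ne',
    Real.arctan_tan (by linarith) (by linarith)]
  field_simp
  ring

lemma lineAngle_injective (hα : 0 < α) : Function.Injective (lineAngle α β) := fun x y h => by
  rw [← tan_lineAngle (β := β) hα x, h, tan_lineAngle hα]

lemma hasDerivAt_lineAngle (hα : 0 < α) (x : ℝ) :
    HasDerivAt (lineAngle α β) (-ProbabilityTheory.cauchyPDFReal β α.toNNReal x) x := by
  have h := (((((hasDerivAt_id x).sub_const β).div_const α).arctan).div_const Real.pi).const_sub
    (1 / 2)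
  refine h.congr_deriv ?_
  rw [ProbabilityTheory.cauchyPDFReal_def, Real.coe_toNNReal α hα.le]
  have := Real.pi_ne_zero
  simp only [id]
  field_simp
  ring

lemma toNNReal_ne_zero_of_pos (hα : 0 < α) : α.toNNReal ≠ 0 := by simpa using hα

/-- The angle is injective with derivative minus the Cauchy density, so the Jacobian in the change
of variables is exactly that density. -/
lemma map_lineAngle_cauchyMeasure (hα : 0 < α) :
    (ProbabilityTheory.cauchyMeasure β α.toNNReal).map (lineAngle α β) =
      volume.restrict (Set.Ioo 0 1) := by
  ext A hA
  rw [Measure.map_apply measurable_lineAngle hA,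
    ProbabilityTheory.cauchyMeasure_of_scale_ne_zero β (toNNReal_ne_zero_of_pos hα),
    withDensity_apply _ (measurable_lineAngle hA), ← lintegral_indicator (measurable_lineAngle hA),
    ← lintegral_indicator_one hA, ← range_lineAngle (β := β) hα, ← Set.image_univ,
    lintegral_image_eq_lintegral_abs_deriv_mul MeasurableSet.univ
      (fun x _ => (hasDerivAt_lineAngle hα x).hasDerivWithinAt) (lineAngle_injective hα).injOn,
    setLIntegral_univ]
  refine lintegral_congr fun x => ?_
  rw [abs_neg, abs_of_pos (ProbabilityTheory.cauchyPDF_pos β (toNNReal_ne_zero_of_pos hα) x)]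
  by_cases hx : lineAngle α β x ∈ A
  · rw [Set.indicator_of_mem hx, Set.indicator_of_mem (Set.mem_preimage.2 hx)]
    simp [ProbabilityTheory.cauchyPDF]
  · rw [Set.indicator_of_notMem hx, Set.indicator_of_notMem fun h => hx (Set.mem_preimage.1 h),
      mul_zero]

lemma measurePreserving_lineToCircle (hα : 0 < α) :
    MeasurePreserving (lineToCircle α β) (ProbabilityTheory.cauchyMeasure β α.toNNReal) volume := by
  have h1 : MeasurePreserving (lineAngle α β) (ProbabilityTheory.cauchyMeasure β α.toNNReal)
      (volume.restrict (Set.Ioc 0 (0 + 1))) := by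
    refine ⟨measurable_lineAngle, ?_⟩
    rw [map_lineAngle_cauchyMeasure hα, zero_add]
    exact Measure.restrict_congr_set Ioo_ae_eq_Ioc
  exact (UnitAddCircle.measurePreserving_mk 0).comp h1

lemma measurePreserving_circleToLine (hα : 0 < α) :
    MeasurePreserving (circleToLine α β) volume
      (ProbabilityTheory.cauchyMeasure β α.toNNReal) := by
  refine ⟨measurable_circleToLine, ?_⟩
  rw [← (measurePreserving_lineToCircle (β := β) hα).map_eq,
    Measure.map_map measurable_circleToLine measurable_lineToCircle]
  have : circleToLine α β ∘ lineToCircle α β = id := funext (circleToLine_lineToCircle hα)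
  rw [this, Measure.map_id]

lemma volume_absolutelyContinuous_cauchyMeasure (hα : 0 < α) :
    (volume : Measure ℝ) ≪ ProbabilityTheory.cauchyMeasure β α.toNNReal := by
  rw [ProbabilityTheory.cauchyMeasure_of_scale_ne_zero β (toNNReal_ne_zero_of_pos hα)]
  refine withDensity_absolutelyContinuous'
    (ProbabilityTheory.measurable_cauchyPDF β α.toNNReal).aemeasurable
    (Eventually.of_forall fun x => ?_)
  rw [ProbabilityTheory.cauchyPDF_def, ne_eq, ENNReal.ofReal_eq_zero, not_le]
  exact ProbabilityTheory.cauchyPDF_pos β (toNNReal_ne_zero_of_pos hα) x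

lemma tan_two_arctan_sub (y : ℝ) :
    Real.tan (2 * Real.arctan y - Real.pi / 2) = (y - 1 / y) / 2 := by
  rw [← neg_sub, Real.tan_neg, Real.tan_pi_div_two_sub, Real.tan_two_mul, Real.tan_arctan, inv_div]
  rcases eq_or_ne y 0 with rfl | hy
  · simp
  · field_simp
    ring

lemma arctan_half_sub_inv_of_pos {y : ℝ} (hy : 0 < y) :
    Real.arctan ((y - 1 / y) / 2) = 2 * Real.arctan y - Real.pi / 2 := by
  have h1 := Real.arctan_pos.2 hy
  have h2 := Real.arctan_lt_pi_div_two y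
  rw [← tan_two_arctan_sub, Real.arctan_tan (by linarith) (by linarith)]

lemma arctan_half_sub_inv_of_neg {y : ℝ} (hy : y < 0) :
    Real.arctan ((y - 1 / y) / 2) = 2 * Real.arctan y + Real.pi / 2 := by
  have h := arctan_half_sub_inv_of_pos (neg_pos.2 hy)
  rw [Real.arctan_neg, show (-y - 1 / -y) / 2 = -((y - 1 / y) / 2) by rw [div_neg]; ring,
    Real.arctan_neg] at h
  linarith

lemma booleMap_sub_div (hα : 0 < α) {x : ℝ} (hx : x ≠ β) :
    (booleMap α β x - β) / α = ((x - β) / α - 1 / ((x - β) / α)) / 2 := by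
  have : x - β ≠ 0 := sub_ne_zero.2 hx
  rw [booleMap, if_neg hx]
  field_simp
  ring

/-- In the coordinate `y = (x - β) / α` the map is `y ↦ (y - 1 / y) / 2`, which doubles the angle.
The branches `y > 0` and `y < 0` differ by a full period, invisible on the circle. -/
lemma lineToCircle_booleMap (hα : 0 < α) {x : ℝ} (hx : x ≠ β) :
    lineToCircle α β (booleMap α β x) = doubling (lineToCircle α β x) := by
  have hπ := Real.pi_ne_zero
  rw [doubling, lineToCircle, lineToCircle, ← AddCircle.coe_nsmul]
  unfold lineAngle
  rw [booleMap_sub_div hα hx]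
  have hy : (x - β) / α ≠ 0 := div_ne_zero (sub_ne_zero.2 hx) hα.ne'
  rcases lt_or_gt_of_ne hy with hy | hy
  · rw [arctan_half_sub_inv_of_neg hy, ← AddCircle.coe_add_period]
    congr 1
    simp only [nsmul_eq_mul]
    field_simp
    push_cast
    ring
  · rw [arctan_half_sub_inv_of_pos hy]
    congr 1
    simp only [nsmul_eq_mul]
    field_simp
    push_cast
    ring

lemma doubling_lineToCircle_self : doubling (lineToCircle α β β) = 0 := by
  rw [doubling, lineToCircle, ← AddCircle.coe_nsmul]
  simp [lineAngle]

lemma volume_singleton_unitAddCircle (u : UnitAddCircle) : volume ({u} : Set UnitAddCircle) = 0 := by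
  simpa using AddCircle.volume_closedBall 1 (x := u) 0

lemma ae_doubling_iterate_ne_zero :
    ∀ᵐ u : UnitAddCircle, ∀ n, doubling^[n] u ≠ 0 := by
  refine ae_all_iff.2 fun n => ?_
  refine (measurePreserving_doubling.iterate n).quasiMeasurePreserving.ae (p := fun u => u ≠ 0) ?_
  exact measure_eq_zero_iff_ae_notMem.1 (volume_singleton_unitAddCircle 0)

/-- The conjugacy can fail only at `β`, whose angle `1 / 2` doubles to the origin. Almost every
doubling orbit avoids the origin, so almost every orbit avoids `β`. -/
lemma ae_lineToCircle_booleMap_iterate (hα : 0 < α) :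
    ∀ᵐ x ∂(ProbabilityTheory.cauchyMeasure β α.toNNReal), ∀ n,
      lineToCircle α β ((booleMap α β)^[n] x) = doubling^[n] (lineToCircle α β x) := by
  filter_upwards [(measurePreserving_lineToCircle (β := β) hα).quasiMeasurePreserving.ae
    ae_doubling_iterate_ne_zero] with x hx n
  induction n with
  | zero => rfl
  | succ n ih =>
    rw [Function.iterate_succ_apply', Function.iterate_succ_apply', ← ih,
      lineToCircle_booleMap hα]
    intro h
    apply hx (n + 1)
    rw [Function.iterate_succ_apply', ← ih, h, doubling_lineToCircle_self]

/-- `|cot(π t)| ≤ 1 / sin(π t)`, and Jordan's inequality gives `sin(π t) ≥ 2 ‖u‖ > 2⁻ʲ`. -/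
lemma abs_circleToLine_le (hα : 0 < α) {u : UnitAddCircle} {j : ℕ} (hu : u ∉ dyadicBall (j + 1)) :
    |circleToLine α β u| ≤ |β| + α * 2 ^ j := by
  set t : ℝ := (AddCircle.equivIco 1 0 u : ℝ) with ht
  have hmem : t ∈ Set.Ico (0 : ℝ) (0 + 1) := (AddCircle.equivIco 1 0 u).2
  rw [zero_add] at hmem
  have htu : (t : UnitAddCircle) = u := AddCircle.coe_equivIco
  have hn : (1 / 2) ^ (j + 1) < ‖u‖ := not_le.1 fun h => hu (mem_dyadicBall.2 h)
  have hπ := Real.pi_pos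
  have hle : ∀ x : ℝ, ‖(x : UnitAddCircle)‖ ≤ |x| := fun x => by
    rw [UnitAddCircle.norm_eq]
    simpa using round_le x 0
  have hn1 : ‖u‖ ≤ t := by
    rw [← htu]; exact (hle t).trans_eq (abs_of_nonneg hmem.1)
  have hn2 : ‖u‖ ≤ 1 - t := by
    have h : ((t - 1 : ℝ) : UnitAddCircle) = u := by rw [AddCircle.coe_sub, AddCircle.coe_period, sub_zero, htu]
    rw [← h]
    refine (hle _).trans_eq ?_
    rw [abs_of_nonpos (by linarith [hmem.2])]; ring
  have hsin : 2 * ‖u‖ ≤ Real.sin (Real.pi * t) := by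
    rcases le_total t (1 / 2) with h | h
    · have := Real.mul_le_sin (x := Real.pi * t) (mul_nonneg hπ.le hmem.1) (by nlinarith)
      have h2 : 2 / Real.pi * (Real.pi * t) = 2 * t := by field_simp
      linarith
    · have := Real.mul_le_sin (x := Real.pi * (1 - t))
        (mul_nonneg hπ.le (by linarith [hmem.2])) (by nlinarith)
      have h2 : 2 / Real.pi * (Real.pi * (1 - t)) = 2 * (1 - t) := by field_simp
      rw [show Real.pi * (1 - t) = Real.pi - Real.pi * t by ring, Real.sin_pi_sub,
        show Real.pi - Real.pi * t = Real.pi * (1 - t) by ring] at this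
      linarith
  have hpow : (0 : ℝ) < (1 / 2) ^ j := by positivity
  have hsin' : (1 / 2) ^ j ≤ Real.sin (Real.pi * t) := by
    rw [pow_succ] at hn; linarith
  have htan : |Real.tan (Real.pi / 2 - Real.pi * t)| ≤ 2 ^ j := by
    rw [Real.tan_eq_sin_div_cos, Real.sin_pi_div_two_sub, Real.cos_pi_div_two_sub, abs_div,
      abs_of_pos (hpow.trans_le hsin'), div_le_iff₀ (hpow.trans_le hsin')]
    calc |Real.cos (Real.pi * t)| ≤ 1 := Real.abs_cos_le_one _
      _ = 2 ^ j * (1 / 2) ^ j := by rw [← mul_pow]; simp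
      _ ≤ _ := by gcongr
  rw [circleToLine]
  refine (abs_add_le _ _).trans ?_
  rw [abs_mul, abs_of_pos hα]
  gcongr

end Conjugacy

/-! ### Growth along vertical lines and integrability -/

lemma exists_norm_le_one_add_abs_rpow {h : ℝ → ℂ} (hc : Continuous h) {a κ : ℝ} (haκ : a ≤ κ)
    (hκ : 0 ≤ κ) (hO : h =O[cocompact ℝ] fun t => |t| ^ a) :
    ∃ C : ℝ, 0 < C ∧ ∀ t, ‖h t‖ ≤ C * (1 + |t|) ^ κ := by
  obtain ⟨c, hc'⟩ := hO.bound
  have h1 : ∀ᶠ t : ℝ in cocompact ℝ, 1 ≤ |t| :=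
    (tendsto_norm_cocompact_atTop (E := ℝ)).eventually_ge_atTop 1
  obtain ⟨K, hK, hKs⟩ := mem_cocompact.1 (hc'.and h1)
  obtain ⟨B, hB⟩ := hK.exists_bound_of_continuousOn hc.continuousOn
  refine ⟨max 1 (max c B), by positivity, fun t => ?_⟩
  have hone : 1 ≤ (1 + |t|) ^ κ := Real.one_le_rpow (by linarith [abs_nonneg t]) hκ
  by_cases ht : t ∈ K
  · calc ‖h t‖ ≤ B := hB t ht
      _ ≤ max 1 (max c B) := (le_max_right _ _).trans (le_max_right _ _)
      _ ≤ max 1 (max c B) * (1 + |t|) ^ κ := le_mul_of_one_le_right (by positivity) hone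
  · obtain ⟨h2, h3⟩ := hKs ht
    have hpow : ‖|t| ^ a‖ ≤ (1 + |t|) ^ κ := by
      rw [Real.norm_of_nonneg (by positivity)]
      exact (Real.rpow_le_rpow_of_exponent_le h3 haκ).trans
        (Real.rpow_le_rpow (abs_nonneg t) (by linarith) hκ)
    calc ‖h t‖ ≤ c * ‖|t| ^ a‖ := h2
      _ ≤ max 1 (max c B) * ‖|t| ^ a‖ := by
        gcongr; exact (le_max_left _ _).trans (le_max_right _ _)
      _ ≤ _ := by gcongr

lemma exists_norm_shift_le {h : ℝ → ℂ} {κ C : ℝ} (hκ : 0 ≤ κ) (hC : 0 < C)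
    (hh : ∀ t, ‖h t‖ ≤ C * (1 + |t|) ^ κ) (t₀ : ℝ) :
    ∃ D : ℝ, 0 < D ∧ ∀ t, ‖h (t₀ + t)‖ ≤ D * (1 + |t|) ^ κ := by
  refine ⟨C * (1 + |t₀|) ^ κ, by positivity, fun t => (hh _).trans ?_⟩
  rw [mul_assoc, ← Real.mul_rpow (by positivity) (by positivity)]
  gcongr
  nlinarith [abs_add_le t₀ t, abs_nonneg t₀, abs_nonneg t, mul_nonneg (abs_nonneg t₀) (abs_nonneg t)]

lemma cauchyPDFReal_le {α : ℝ} (β : ℝ) (hα : 0 < α) :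
    ∃ D : ℝ, 0 < D ∧ ∀ x,
      ProbabilityTheory.cauchyPDFReal β α.toNNReal x ≤ D * (1 + |x|) ^ (-2 : ℝ) := by
  set E := 2 * (1 + |β|) ^ 2 / α ^ 2 + 2 with hE
  have hE0 : 0 < E := by positivity
  have hπ := Real.pi_pos
  refine ⟨Real.pi⁻¹ * α * E, by positivity, fun x => ?_⟩
  rw [ProbabilityTheory.cauchyPDFReal_def, Real.coe_toNNReal α hα.le, mul_assoc (Real.pi⁻¹ * α)]
  refine mul_le_mul_of_nonneg_left ?_ (by positivity)
  rw [Real.rpow_neg (by positivity), Real.rpow_two, ← div_eq_mul_inv, le_div_iff₀ (by positivity),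
    inv_mul_le_iff₀ (by positivity)]
  have h1 : 1 + |x| ≤ (1 + |β|) + |x - β| := by
    have := abs_add_le (x - β) β
    rw [sub_add_cancel] at this
    linarith
  have h2 : (1 + |x|) ^ 2 ≤ ((1 + |β|) + |x - β|) ^ 2 := by gcongr
  have h3 : ((1 + |β|) + |x - β|) ^ 2 ≤ 2 * (1 + |β|) ^ 2 + 2 * (x - β) ^ 2 := by
    rw [← sq_abs (x - β)]
    nlinarith [sq_nonneg ((1 + |β|) - |x - β|)]
  have h4 : ((x - β) ^ 2 + α ^ 2) * E = 2 * (1 + |β|) ^ 2 + 2 * (x - β) ^ 2 +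
      ((x - β) ^ 2 * (2 * (1 + |β|) ^ 2 / α ^ 2) + 2 * α ^ 2) := by
    rw [hE]; field_simp; ring
  have h5 : 0 ≤ (x - β) ^ 2 * (2 * (1 + |β|) ^ 2 / α ^ 2) + 2 * α ^ 2 := by positivity
  linarith

lemma toReal_cauchyPDF {α : ℝ} (β : ℝ) (hα : 0 < α) (x : ℝ) :
    (ProbabilityTheory.cauchyPDF β α.toNNReal x).toReal =
      ProbabilityTheory.cauchyPDFReal β α.toNNReal x := by
  rw [ProbabilityTheory.cauchyPDF_def,
    ENNReal.toReal_ofReal (ProbabilityTheory.cauchyPDF_pos β (toNNReal_ne_zero_of_pos hα) x).le]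

lemma integrable_cauchyMeasure_iff {E : Type*} [NormedAddCommGroup E] [NormedSpace ℝ E] {α β : ℝ}
    (hα : 0 < α) {g : ℝ → E} :
    Integrable g (ProbabilityTheory.cauchyMeasure β α.toNNReal) ↔
      Integrable (fun x => ProbabilityTheory.cauchyPDFReal β α.toNNReal x • g x) := by
  rw [ProbabilityTheory.cauchyMeasure_of_scale_ne_zero β (toNNReal_ne_zero_of_pos hα),
    integrable_withDensity_iff_integrable_smul' (ProbabilityTheory.measurable_cauchyPDF β _)
      (Eventually.of_forall fun x => ENNReal.ofReal_lt_top)]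
  simp only [toReal_cauchyPDF β hα]

lemma integral_cauchyMeasure {E : Type*} [NormedAddCommGroup E] [NormedSpace ℝ E] {α β : ℝ}
    (hα : 0 < α) (g : ℝ → E) :
    ∫ x, g x ∂(ProbabilityTheory.cauchyMeasure β α.toNNReal) =
      ∫ x, ProbabilityTheory.cauchyPDFReal β α.toNNReal x • g x := by
  rw [ProbabilityTheory.cauchyMeasure_of_scale_ne_zero β (toNNReal_ne_zero_of_pos hα),
    integral_withDensity_eq_integral_toReal_smul (ProbabilityTheory.measurable_cauchyPDF β _)
      (Eventually.of_forall fun x => ENNReal.ofReal_lt_top)]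
  simp only [toReal_cauchyPDF β hα]

lemma cauchyPDFReal_smul_eq {α β : ℝ} (hα : 0 < α) (g : ℝ → ℂ) (x : ℝ) :
    ProbabilityTheory.cauchyPDFReal β α.toNNReal x • g x =
      ((α / Real.pi : ℝ) : ℂ) * (g x / ((α : ℂ) ^ 2 + ((x : ℂ) - (β : ℂ)) ^ 2)) := by
  rw [ProbabilityTheory.cauchyPDFReal_def, Real.coe_toNNReal α hα.le, Complex.real_smul]
  push_cast
  rw [add_comm ((α : ℂ) ^ 2), div_eq_mul_inv, div_eq_mul_inv]
  ring

/-- The density decays like `(1 + |t|) ^ (-2)`, so the `q`-th power has integrand of order `(1 +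
|t|) ^ (κ * q - 2)`, integrable because `κ * q < 1`. -/
lemma memLp_cauchyMeasure_of_growth {α : ℝ} (β : ℝ) (hα : 0 < α) {g : ℝ → ℂ} (hg : Continuous g)
    {κ C q : ℝ} (hC : 0 < C) (hbound : ∀ t, ‖g t‖ ≤ C * (1 + |t|) ^ κ) (hq : 1 ≤ q)
    (hqκ : κ * q < 1) :
    MemLp g (ENNReal.ofReal q) (ProbabilityTheory.cauchyMeasure β α.toNNReal) := by
  have hq0 : 0 < q := by linarith
  rw [← integrable_norm_rpow_iff hg.aestronglyMeasurable (by simpa using hq0)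
    ENNReal.ofReal_ne_top, ENNReal.toReal_ofReal hq0.le, integrable_cauchyMeasure_iff hα]
  obtain ⟨D, hD, hpdf⟩ := cauchyPDFReal_le β hα
  have hint : Integrable fun t : ℝ => D * C ^ q * (1 + ‖t‖) ^ (-(2 - κ * q)) :=
    (integrable_one_add_norm (by simp; linarith)).const_mul _
  refine hint.mono' ?_ (Eventually.of_forall fun t => ?_)
  · refine AEStronglyMeasurable.smul
      (ProbabilityTheory.measurable_cauchyPDFReal β _).aestronglyMeasurable ?_
    exact (hg.norm.rpow_const fun x => Or.inr hq0.le).aestronglyMeasurable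
  · have hp0 := (ProbabilityTheory.cauchyPDF_pos β (toNNReal_ne_zero_of_pos hα) t).le
    have h1 : (0 : ℝ) < 1 + |t| := by positivity
    rw [norm_smul, Real.norm_of_nonneg hp0, Real.norm_of_nonneg (by positivity), Real.norm_eq_abs]
    calc _ ≤ D * (1 + |t|) ^ (-2 : ℝ) * (C * (1 + |t|) ^ κ) ^ q := by
          gcongr
          · exact hpdf t
          · exact hbound t
      _ = _ := by
        rw [Real.mul_rpow hC.le (by positivity), ← Real.rpow_mul h1.le,
          show (-(2 - κ * q)) = -2 + κ * q by ring, Real.rpow_add h1]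
        ring

/-! ### Ergodic averages of functions of moderate growth along the Boole map -/

/-- Outside the ball of index `j + 1` the line coordinate is `O(2 ^ j)`, so growth of exponent `κ`
on the line becomes growth by `θ = 2 ^ κ` per dyadic scale; `κ < 1` is what makes `θ < 2`. -/
lemma norm_comp_circleToLine_le {α : ℝ} (β : ℝ) (hα : 0 < α) {g : ℝ → ℂ} {κ C : ℝ} (hκ : 0 ≤ κ)
    (hC : 0 < C) (hbound : ∀ t, ‖g t‖ ≤ C * (1 + |t|) ^ κ) {j : ℕ} {u : UnitAddCircle}
    (hu : u ∉ dyadicBall (j + 1)) :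
    ‖g (circleToLine α β u)‖ ≤ C * (1 + |β| + α) ^ κ * ((2 : ℝ) ^ κ) ^ (j + 1) := by
  refine (hbound _).trans ?_
  rw [mul_assoc, ← Real.rpow_natCast, ← Real.rpow_mul (by norm_num), mul_comm κ,
    Real.rpow_mul (by norm_num), Real.rpow_natCast, ← Real.mul_rpow (by positivity) (by positivity)]
  gcongr
  have h1 : (1 : ℝ) ≤ 2 ^ (j + 1) := one_le_pow₀ (by norm_num)
  have h2 : (2 : ℝ) ^ j ≤ 2 ^ (j + 1) := pow_le_pow_right₀ (by norm_num) (by omega)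
  have h3 := abs_circleToLine_le (β := β) hα hu
  have h4 : 1 + |β| ≤ (1 + |β|) * 2 ^ (j + 1) := le_mul_of_one_le_right (by positivity) h1
  have h5 : α * 2 ^ j ≤ α * 2 ^ (j + 1) := by gcongr
  linarith

lemma ae_tendsto_average_booleMap {α : ℝ} (β : ℝ) (hα : 0 < α) {g : ℝ → ℂ} (hg : Continuous g)
    {κ C : ℝ} (hκ : 0 < κ) (hκ1 : κ < 1) (hC : 0 < C) (hbound : ∀ t, ‖g t‖ ≤ C * (1 + |t|) ^ κ)
    {p : ENNReal} (hp : 1 ≤ p) {k : ℕ → ℕ} (hgood : IsGoodUniversal p k)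
    (hud : UniformlyDistributedInt k)
    (h : MemLp g p (ProbabilityTheory.cauchyMeasure β α.toNNReal) ∨ Function.Injective k) :
    ∀ᵐ x : ℝ, Tendsto (fun N => timeAverage (booleMap α β) k g N x) atTop
      (𝓝 (∫ y, g y ∂(ProbabilityTheory.cauchyMeasure β α.toNNReal))) := by
  have hmp := measurePreserving_circleToLine (β := β) hα
  set G : UnitAddCircle → ℂ := g ∘ circleToLine α β with hG
  have hgi : Integrable g (ProbabilityTheory.cauchyMeasure β α.toNNReal) := by
    have := memLp_cauchyMeasure_of_growth β hα hg hC hbound le_rfl (by simpa using hκ1)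
    rwa [ENNReal.ofReal_one, memLp_one_iff_integrable] at this
  have hGi : Integrable G := hmp.integrable_comp_of_integrable hgi
  have hint : ∫ u, G u = ∫ y, g y ∂(ProbabilityTheory.cauchyMeasure β α.toNNReal) := by
    rw [← hmp.map_eq, integral_map hmp.measurable.aemeasurable hg.aestronglyMeasurable]
    rfl
  have hcircle : ∀ᵐ u : UnitAddCircle, Tendsto (fun N => timeAverage doubling k G N u) atTop
      (𝓝 (∫ v, G v)) := by
    rcases h with h | h
    · exact ae_tendsto_timeAverage_doubling hp hgood hud (h.comp_measurePreserving hmp)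
    · refine ae_tendsto_timeAverage_of_injective hp hgood hud h
        (C := C * (1 + |β| + α) ^ κ) (θ := 2 ^ κ) (by positivity)
        (Real.one_lt_rpow (by norm_num) hκ) ?_ hGi
        fun j u hu => norm_comp_circleToLine_le β hα hκ.le hC hbound hu
      calc (2 : ℝ) ^ κ < 2 ^ (1 : ℝ) := Real.rpow_lt_rpow_of_exponent_lt (by norm_num) hκ1
        _ = 2 := Real.rpow_one 2
  rw [hint] at hcircle
  -- The Cauchy density is positive everywhere, so a Cauchy-null set is Lebesgue-null.
  refine (volume_absolutelyContinuous_cauchyMeasure (β := β) hα).ae_le ?_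
  filter_upwards [(measurePreserving_lineToCircle (β := β) hα).quasiMeasurePreserving.ae hcircle,
    ae_lineToCircle_booleMap_iterate (β := β) hα] with x hx hconj
  refine hx.congr fun N => ?_
  simp only [timeAverage, hG, Function.comp_apply, ← hconj, circleToLine_lineToCircle hα]

theorem theorem1
    (c : ℝ) (f : ℂ → ℂ) (hf : IsMeromorphicFunctionOn f {z : ℂ | c < z.re})
    (hbdd : ∃ K c' : ℝ, 0 < K ∧ c < c' ∧
      ∀ σ t : ℝ, c' < σ → ‖f ((σ : ℂ) + (t : ℂ) * Complex.I)‖ ≤ K)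
    (ν : ℝ → ℝ) (hνanti : AntitoneOn ν (Set.Ioi c))
    (hνc : ∀ᶠ σ in 𝓝[>] c, ν σ ≤ 1 + c - σ)
    (hgrowth : ∀ σ : ℝ, c < σ → ∀ ε : ℝ, 0 < ε →
      (fun t : ℝ => f ((σ : ℂ) + (t : ℂ) * Complex.I))
        =O[cocompact ℝ] (fun t : ℝ => |t| ^ (ν σ + ε)))
    (hpole : ∀ z w : ℂ, c < z.re → c < w.re → IsPoleOf f z → IsPoleOf f w → z = w)
    (α β : ℝ) (hα : 0 < α)
    (p : ENNReal) (hp : 1 ≤ p)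
    (k : ℕ → ℕ) (hgood : IsGoodUniversal p k) (hhart : HartmanUniformlyDistributed k)
    (s : ℂ) (hs : c < s.re) (hs0 : ∀ z : ℂ, c < z.re → IsPoleOf f z → s.re ≠ z.re) :
    (∀ q : ℝ, 1 ≤ q → q * ν s.re < 1 →
      MemLp (fun τ : ℝ => f (s + Complex.I * (τ : ℂ))) (ENNReal.ofReal q)
        (ProbabilityTheory.cauchyMeasure β α.toNNReal)) ∧
    Integrable (fun τ : ℝ =>
      f (s + Complex.I * (τ : ℂ)) / ((α : ℂ) ^ 2 + ((τ : ℂ) - (β : ℂ)) ^ 2)) volume ∧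
    ((MemLp (fun τ : ℝ => f (s + Complex.I * (τ : ℂ))) p
        (ProbabilityTheory.cauchyMeasure β α.toNNReal) ∨ Function.Injective k) →
      ∀ᵐ x : ℝ ∂volume,
        Tendsto
          (fun N : ℕ => (1 / (N : ℂ)) *
            ∑ n ∈ Finset.range N,
              f (s + Complex.I * (((booleMap α β)^[k n] x : ℝ) : ℂ)))
          atTop
          (𝓝 (((α / Real.pi : ℝ) : ℂ) *
            ∫ τ : ℝ, f (s + Complex.I * (τ : ℂ)) /
              ((α : ℂ) ^ 2 + ((τ : ℂ) - (β : ℂ)) ^ 2)))) := by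
  set h : ℝ → ℂ := fun t => f ((s.re : ℂ) + (t : ℂ) * Complex.I) with hh
  set g : ℝ → ℂ := fun τ => f (s + Complex.I * (τ : ℂ)) with hg
  have hgh : ∀ τ, g τ = h (s.im + τ) := by
    intro τ
    simp only [hg, hh]
    congr 1
    conv_lhs => rw [← Complex.re_add_im s]
    push_cast
    ring
  have hcont : Continuous h := by
    rw [continuous_iff_continuousAt]
    intro t
    have hre : ((s.re : ℂ) + (t : ℂ) * Complex.I).re = s.re := by simp
    have han : AnalyticAt ℂ f ((s.re : ℂ) + (t : ℂ) * Complex.I) :=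
      hf.2 _ (show c < _ by rw [hre]; exact hs) fun hp =>
        hs0 _ (by rw [hre]; exact hs) hp hre.symm
    exact ContinuousAt.comp (f := fun t : ℝ => (s.re : ℂ) + (t : ℂ) * Complex.I)
      han.continuousAt (by fun_prop)
  have hgcont : Continuous g := by
    rw [funext hgh]
    exact hcont.comp (continuous_const.add continuous_id)
  -- Compare with some `σ` in `(c, s.re)` close to `c`: there `ν s.re ≤ ν σ ≤ 1 + c - σ < 1`.
  have hν1 : ν s.re < 1 := by
    have hIoo : ∀ᶠ σ in 𝓝[>] c, σ ∈ Set.Ioo c s.re := Ioo_mem_nhdsGT hs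
    obtain ⟨σ, h1, h2⟩ := (hνc.and hIoo).exists
    have h3 := hνanti h2.1 hs h2.2.le
    linarith [h2.1]
  have hbound : ∀ κ : ℝ, 0 ≤ κ → ν s.re < κ →
      ∃ C : ℝ, 0 < C ∧ ∀ t, ‖g t‖ ≤ C * (1 + |t|) ^ κ := by
    intro κ hκ0 hκ
    obtain ⟨C, hC, hb⟩ := exists_norm_le_one_add_abs_rpow hcont
      (show ν s.re + (κ - ν s.re) ≤ κ by linarith) hκ0 (hgrowth s.re hs _ (by linarith))
    obtain ⟨D, hD, hb'⟩ := exists_norm_shift_le hκ0 hC hb s.im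
    exact ⟨D, hD, fun t => by rw [hgh]; exact hb' t⟩
  -- `ν s.re` may be negative, yet `κ` has to be strictly positive so that `θ = 2 ^ κ` exceeds one;
  -- hence the choice between `max (ν s.re) 0` and `1 / q`.
  have hexp : ∀ q : ℝ, 1 ≤ q → q * ν s.re < 1 → ∃ κ : ℝ, 0 < κ ∧ ν s.re < κ ∧ κ * q < 1 := by
    intro q hq hqν
    have hq0 : 0 < q := by linarith
    have hmax : max (ν s.re) 0 < 1 / q :=
      max_lt ((lt_div_iff₀ hq0).2 (by linarith)) (by positivity)
    obtain ⟨κ, hκ1, hκ2⟩ := exists_between hmax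
    exact ⟨κ, (le_max_right _ _).trans_lt hκ1, (le_max_left _ _).trans_lt hκ1,
      (lt_div_iff₀ hq0).1 hκ2⟩
  have hmem : ∀ q : ℝ, 1 ≤ q → q * ν s.re < 1 →
      MemLp g (ENNReal.ofReal q) (ProbabilityTheory.cauchyMeasure β α.toNNReal) := by
    intro q hq hqν
    obtain ⟨κ, hκ0, hκ, hκq⟩ := hexp q hq hqν
    obtain ⟨C, hC, hb⟩ := hbound κ hκ0.le hκ
    exact memLp_cauchyMeasure_of_growth β hα hgcont hC hb hq hκq
  have hαπ : ((α / Real.pi : ℝ) : ℂ) ≠ 0 :=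
    Complex.ofReal_ne_zero.2 (div_ne_zero hα.ne' Real.pi_ne_zero)
  refine ⟨hmem, ?_, fun hor => ?_⟩
  · have h1 := hmem 1 le_rfl (by linarith)
    rw [ENNReal.ofReal_one, memLp_one_iff_integrable, integrable_cauchyMeasure_iff hα] at h1
    simp only [cauchyPDFReal_smul_eq hα] at h1
    exact (integrable_const_mul_iff hαπ.isUnit _).1 h1
  · obtain ⟨κ, hκ0, hκ, hκ1⟩ := hexp 1 le_rfl (by linarith)
    obtain ⟨C, hC, hb⟩ := hbound κ hκ0.le hκ
    have hlim := ae_tendsto_average_booleMap β hα hgcont hκ0 (by linarith) hC hb hp hgood hhart.1 hor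
    rw [integral_cauchyMeasure hα] at hlim
    simp only [cauchyPDFReal_smul_eq hα] at hlim
    rwa [integral_const_mul] at hlim
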